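/- **Definitions.** A *positive cone* is a cancellative $\mathbb R_{\ge 0}$-semimodule $P$ with a norm $\|\cdot\|:P\to\mathbb R_{\ge0}$ (homogeneous, subadditive, definite) such that $\|x\|\le\|x+y\|$. Its unit ball is $\mathcal BP=\{x\mid\|x\|\le1\}$, and it is ordered by $x\le y\iff\exists z\; x+z=y$. It is *complete* if every monotone sequence in $\mathcal BP$ has a least upper bound, lying in $\mathcal BP$. A linear map of cones is *continuous* if it preserves the least upper bounds of monotone sequences of the unit ball; $P$ is *separated* if the continuous linear maps $P\to\mathbb R_{\ge0}$ separate its points. $\mathbf{SCCLin}$ is the category of separated complete positive cones and continuous linear maps $f$ with $f(\mathcal BP)\subseteq\mathcal BQ$. The object $P\multimap Q$ is the cone of all continuous linear maps $P\to Q$, with pointwise operations and norm $\|f\|=\sup_{x\in\mathcal BP}\|f(x)\|$; it is functorial by $(f\multimap g)(h)=g\circ h\circ f$. A *bilinear map* $P\times Q\to R$ is a map which is linear and continuous in each argument and maps $\mathcal BP\times\mathcal BQ$ to $\mathcal BR$. A *tensor product* of cones is a functor $\otimes_c:\mathbf{SCCLin}^2\to\mathbf{SCCLin}$ with a bijection $\mathbf{SCCLin}(P\otimes_c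 Q,R)\cong\mathbf{SCCLin}(P,Q\multimap R)$ natural in $P,Q,R$; for $x\in P$, $y\in Q$, let $x\otimes_c y\in P\otimes_cQ$ be the image of $(x,y)$ under the bilinear map $P\times Q\to P\otimes_c Q$ that corresponds to the identity of $P\otimes_cQ$. For $u,u'\in(\mathbb R_{\ge0})^I$ let $\langle u,u'\rangle=\sum_iu_iu'_i$, and for $\mathcal U\subseteq(\mathbb R_{\ge0})^I$ let $\mathcal U^\perp=\{u'\mid\forall u\in\mathcal U\;\langle u,u'\rangle\le1\}$. A *probabilistic coherence space* (PCS) is a pair $X=(|X|,\mathrm PX)$ of a countable set and a set $\mathrm PX=\mathrm PX^{\perp\perp}\subseteq(\mathbb R_{\ge0})^{|X|}$ such that $0<\sup_{u\in\mathrm PX}u_a<\infty$ for all $a\in|X|$. A morphism $X\to Y$ of PCSs is a matrix $t\in(\mathbb R_{\ge0})^{|X|\times|Y|}$ such that $t\cdot u\in\mathrm PY$ for all $u\in\mathrm PX$, where $(t\cdot u)_b=\sum_at_{a,b}u_a$. Put $X\otimes Y=(|X|\times|Y|,\{u\otimes v\mid u\in\mathrm PX,v\in\mathrm PY\}^{\perp\perp})$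 with $(u\otimes v)_{(a,b)}=u_av_b$, and $1=(\{*\},\{u\mid u_*\le1\})$; the associator, unitors and symmetry of PCSs are the evident permutation matrices. Let $\mathrm{Cl}X=\{u\mid\exists\lambda>0\;\lambda u\in\mathrm PX\}$ be the object of $\mathbf{SCCLin}$ with pointwise operations and norm $\|u\|=\sup_{u'\in\mathrm PX^\perp}\langle u,u'\rangle$ (so that its unit ball is $\mathrm PX$), and $\mathrm{Cl}(t)(u)=t\cdot u$. Call $X$ a *cube* if $\mathrm PX=\{u\mid\forall a\;u_a\le1\}$. **Theorem.** A tensor product $\otimes_c$ of cones exists. Let $\otimes_c$ be any such tensor product. 1. For every bilinear map $b:P\times Q\to R$ there is exactly one morphism $\tilde b:P\otimes_cQ\to R$ with $\tilde b(x\otimes_cy)=b(x,y)$ for all $x,y$; it is the morphism that corresponds to $b$ under the natural bijection. In particular $(u,v)\mapsto u\otimes v$ induces a morphism $m_{X,Y}:\mathrm{Cl}X\otimes_c\mathrm{Cl}Y\to\mathrm{Cl}(X\otimes Y)$ for all PCSs $X,Y$, and $m_{X,Y}$ is an isomorphism if $X$ and $Y$ are cubes. 2. There are natural isomorphisms $\alpha_{P,Q,R}:(P\otimes_cQ)\otimes_cR\to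 P\otimes_c(Q\otimes_cR)$, $\lambda_P:\mathbb R_{\ge0}\otimes_cP\to P$, $\rho_P:P\otimes_c\mathbb R_{\ge0}\to P$ and $\sigma_{P,Q}:P\otimes_cQ\to Q\otimes_cP$ whose components at the cones $\mathrm{Cl}X$ of PCSs $X$ correspond to the associator, unitors and symmetry of PCSs along the morphisms $m_{X,Y}$ and the isomorphism $\mathbb R_{\ge0}\cong\mathrm{Cl}1$. They are the only natural isomorphisms with this property, even if it is required only for cubes. On pure tensors, $\alpha((x\otimes_cy)\otimes_cz)=x\otimes_c(y\otimes_cz)$, $\lambda(r\otimes_cx)=rx=\rho(x\otimes_cr)$ and $\sigma(x\otimes_cy)=y\otimes_cx$. 3. $\mathbf{SCCLin}$, with the tensor product $\otimes_c$, the unit $\mathbb R_{\ge0}$ and the natural isomorphisms $\alpha,\lambda,\rho,\sigma$, is a symmetric monoidal category. It is closed: for each $P$, the functor $-\otimes_cP$ is left adjoint to $P\multimap-$, with counit at $Q$ the evaluation $(P\multimap Q)\otimes_cP\to Q$ induced by the bilinear map $(f,x)\mapsto f(x)$, that is, $f\otimes_cx\mapsto f(x)$. -/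

import Mathlib

open CategoryTheory
open scoped NNReal ENNReal

universe u v w

set_option linter.unusedSectionVars false
set_option linter.unusedVariables false

/-! ### Positive cones -/

/-- A positive cone: a cancellative `ℝ≥0`-semimodule with a norm that is monotone for the
algebraic order. -/
class PositiveCone (P : Type u) [AddCommMonoid P] [Module ℝ≥0 P] where
  /-- the norm of the cone -/
  nrm : P → ℝ≥0
  nrm_smul : ∀ (r : ℝ≥0) (x : P), nrm (r • x) = r * nrm x
  nrm_add_le : ∀ x y : P, nrm (x + y) ≤ nrm x + nrm y
  eq_zero_of_nrm_eq_zero : ∀ x : P, nrm x = 0 → x = 0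
  cancel : ∀ x y z : P, x + z = y + z → x = y
  nrm_le_nrm_add : ∀ x y : P, nrm x ≤ nrm (x + y)

open PositiveCone (nrm)

/-- The algebraic order of a commutative monoid. -/
def ConeLE {P : Type u} [AddCommMonoid P] (x y : P) : Prop := ∃ z, x + z = y

/-- Monotone sequences for the algebraic order. -/
def IsMonoSeq {P : Type u} [AddCommMonoid P] (s : ℕ → P) : Prop :=
  ∀ m n, m ≤ n → ConeLE (s m) (s n)

/-- `x` is the least upper bound of the sequence `s` for the algebraic order. -/
def IsSeqLub {P : Type u} [AddCommMonoid P] (s : ℕ → P) (x : P) : Prop :=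
  (∀ n, ConeLE (s n) x) ∧ ∀ y, (∀ n, ConeLE (s n) y) → ConeLE x y

/-- Continuity: preservation of the lubs of monotone sequences of the unit ball.
It is only used for additive maps, which are monotone for the algebraic order. -/
def IsScottCont {P : Type u} {Q : Type v} [AddCommMonoid P] [Module ℝ≥0 P] [PositiveCone P]
    [AddCommMonoid Q] (f : P → Q) : Prop :=
  ∀ (s : ℕ → P) (x : P), IsMonoSeq s → (∀ n, nrm (s n) ≤ 1) → IsSeqLub s x →
    IsSeqLub (fun n => f (s n)) (f x)

/-- Completeness: every monotone sequence of the unit ball has a lub, which lies in the unit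
ball. -/
class CompleteCone (P : Type u) [AddCommMonoid P] [Module ℝ≥0 P] [PositiveCone P] : Prop where
  exists_lub : ∀ s : ℕ → P, IsMonoSeq s → (∀ n, nrm (s n) ≤ 1) →
    ∃ x, nrm x ≤ 1 ∧ IsSeqLub s x

/-- Linear and continuous maps between cones. -/
structure ContLin (P : Type u) (Q : Type v) [AddCommMonoid P] [Module ℝ≥0 P] [PositiveCone P]
    [AddCommMonoid Q] [Module ℝ≥0 Q] extends P →ₗ[ℝ≥0] Q where
  cont : IsScottCont toFun

/-- The cone of nonnegative reals, with the identity as norm. -/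
instance : PositiveCone ℝ≥0 where
  nrm := fun x => x
  nrm_smul := fun _ _ => rfl
  nrm_add_le := fun _ _ => le_rfl
  eq_zero_of_nrm_eq_zero := fun _ h => h
  cancel := fun _ _ _ h => add_right_cancel h
  nrm_le_nrm_add := fun _ _ => le_self_add

/-- A cone is separated when the linear and continuous maps to `ℝ≥0` separate its points. -/
class SeparatedCone (P : Type u) [AddCommMonoid P] [Module ℝ≥0 P] [PositiveCone P] : Prop where
  sep : ∀ x y : P, (∀ f : ContLin P ℝ≥0, f.toFun x = f.toFun y) → x = y

section Order

variable {P : Type u} [AddCommMonoid P]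

lemma ConeLE.refl (x : P) : ConeLE x x := ⟨0, add_zero x⟩

lemma ConeLE.trans {x y z : P} (h : ConeLE x y) (h' : ConeLE y z) : ConeLE x z := by
  obtain ⟨a, rfl⟩ := h
  obtain ⟨b, rfl⟩ := h'
  exact ⟨a + b, by rw [add_assoc]⟩

lemma ConeLE.add {x y x' y' : P} (h : ConeLE x y) (h' : ConeLE x' y') :
    ConeLE (x + x') (y + y') := by
  obtain ⟨a, rfl⟩ := h
  obtain ⟨b, rfl⟩ := h'
  exact ⟨a + b, by abel⟩

variable [Module ℝ≥0 P]

lemma ConeLE.smul {x y : P} (r : ℝ≥0) (h : ConeLE x y) : ConeLE (r • x) (r • y) := by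
  obtain ⟨a, rfl⟩ := h
  exact ⟨r • a, (smul_add _ _ _).symm⟩

lemma ConeLE.map {Q : Type v} [AddCommMonoid Q] [Module ℝ≥0 Q] (f : P →ₗ[ℝ≥0] Q) {x y : P}
    (h : ConeLE x y) : ConeLE (f x) (f y) := by
  obtain ⟨a, rfl⟩ := h
  exact ⟨f a, (map_add f _ _).symm⟩

lemma IsMonoSeq.map {Q : Type v} [AddCommMonoid Q] [Module ℝ≥0 Q] (f : P →ₗ[ℝ≥0] Q)
    {s : ℕ → P} (h : IsMonoSeq s) : IsMonoSeq (fun n => f (s n)) :=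
  fun m n hmn => (h m n hmn).map f

lemma IsMonoSeq.smul (r : ℝ≥0) {s : ℕ → P} (h : IsMonoSeq s) : IsMonoSeq (fun n => r • s n) :=
  fun m n hmn => (h m n hmn).smul r

lemma IsSeqLub.smul {r : ℝ≥0} (hr : r ≠ 0) {s : ℕ → P} {x : P} (h : IsSeqLub s x) :
    IsSeqLub (fun n => r • s n) (r • x) := by
  refine ⟨fun n => (h.1 n).smul r, fun y hy => ?_⟩
  have := (h.2 (r⁻¹ • y) fun n => by
    have := (hy n).smul r⁻¹
    rwa [inv_smul_smul₀ hr] at this).smul r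
  rwa [smul_inv_smul₀ hr] at this

variable [PositiveCone P]

lemma PositiveCone.nrm_zero : nrm (0 : P) = 0 := by
  have := PositiveCone.nrm_smul (0 : ℝ≥0) (0 : P)
  simpa using this

lemma ConeLE.nrm_le {x y : P} (h : ConeLE x y) : nrm x ≤ nrm y := by
  obtain ⟨a, rfl⟩ := h
  exact PositiveCone.nrm_le_nrm_add _ _

lemma ConeLE.antisymm {x y : P} (h : ConeLE x y) (h' : ConeLE y x) : x = y := by
  obtain ⟨a, rfl⟩ := h
  obtain ⟨b, hb⟩ := h'
  have h0 : a + b = 0 := by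
    refine PositiveCone.cancel _ _ x ?_
    calc a + b + x = x + a + b := by abel
      _ = 0 + x := by rw [hb, zero_add]
  have : nrm a = 0 := by
    have := PositiveCone.nrm_le_nrm_add a b
    rw [h0, PositiveCone.nrm_zero] at this
    exact le_antisymm this zero_le
  rw [PositiveCone.eq_zero_of_nrm_eq_zero a this, add_zero]

lemma ConeLE.of_add_le_add {x y z : P} (h : ConeLE (x + z) (y + z)) : ConeLE x y := by
  obtain ⟨a, ha⟩ := h
  refine ⟨a, PositiveCone.cancel _ _ z ?_⟩
  rw [← ha]; abel

lemma IsSeqLub.unique {s : ℕ → P} {x y : P} (h : IsSeqLub s x) (h' : IsSeqLub s y) : x = y :=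
  (h.2 y h'.1).antisymm (h'.2 x h.1)

lemma IsSeqLub.add_const {s : ℕ → P} {x z : P} (y : P) (h : IsSeqLub s x)
    (hz : ∀ n, ConeLE (s n + y) z) : ConeLE (x + y) z := by
  obtain ⟨a, rfl⟩ := (show ConeLE y (s 0 + y) from ⟨s 0, add_comm _ _⟩).trans (hz 0)
  rw [add_comm x y]
  refine (ConeLE.refl y).add (h.2 a fun n => ?_)
  exact ConeLE.of_add_le_add (z := y) (by rw [add_comm a y]; exact hz n)

lemma IsSeqLub.add {s t : ℕ → P} {x y : P} (hs : IsMonoSeq s) (ht : IsMonoSeq t)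
    (h : IsSeqLub s x) (h' : IsSeqLub t y) : IsSeqLub (fun n => s n + t n) (x + y) := by
  refine ⟨fun n => (h.1 n).add (h'.1 n), fun z hz => ?_⟩
  refine h.add_const y fun m => ?_
  rw [add_comm]
  refine h'.add_const (s m) fun n => ?_
  rw [add_comm]
  exact ((hs m _ (le_max_left m n)).add (ht n _ (le_max_right m n))).trans (hz (max m n))

lemma IsScottCont.of_bdd {Q : Type v} [AddCommMonoid Q] [Module ℝ≥0 Q] {f : P →ₗ[ℝ≥0] Q}
    (hf : IsScottCont f) {s : ℕ → P} {x : P} (hs : IsMonoSeq s) {r : ℝ≥0}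
    (hr : ∀ n, nrm (s n) ≤ r) (hx : IsSeqLub s x) : IsSeqLub (fun n => f (s n)) (f x) := by
  have h1 : (r + 1) ≠ 0 := by positivity
  have := (hf (fun n => (r + 1)⁻¹ • s n) ((r + 1)⁻¹ • x) (hs.smul _)
    (fun n => by
      rw [PositiveCone.nrm_smul, inv_mul_le_iff₀ (by positivity), mul_one]
      exact (hr n).trans le_self_add) (hx.smul (inv_ne_zero h1))).smul h1
  simpa [map_smul, smul_inv_smul₀ h1] using this

lemma IsSeqLub.nrm_le [CompleteCone P] {s : ℕ → P} {x : P} (hs : IsMonoSeq s) {r : ℝ≥0}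
    (hr : ∀ n, nrm (s n) ≤ r) (hx : IsSeqLub s x) : nrm x ≤ r := by
  rcases eq_or_ne r 0 with rfl | h
  · have : ∀ n, s n = 0 := fun n =>
      PositiveCone.eq_zero_of_nrm_eq_zero _ (le_antisymm (hr n) zero_le)
    have h2 := (hx.2 0 fun n => by rw [this n]; exact ConeLE.refl _).nrm_le
    rwa [PositiveCone.nrm_zero] at h2
  · obtain ⟨y, hy, hy'⟩ := CompleteCone.exists_lub (fun n => r⁻¹ • s n) (hs.smul _) (fun n => by
      rw [PositiveCone.nrm_smul]
      exact (mul_le_mul_right (hr n) _).trans (inv_mul_cancel₀ h).le)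
    have := hy'.unique (hx.smul (inv_ne_zero h))
    rw [this, PositiveCone.nrm_smul, inv_mul_le_iff₀ (pos_iff_ne_zero.2 h), mul_one] at hy
    exact hy

lemma CompleteCone.exists_lub_of_bdd [CompleteCone P] {s : ℕ → P} (hs : IsMonoSeq s) {r : ℝ≥0}
    (hr : ∀ n, nrm (s n) ≤ r) : ∃ x, IsSeqLub s x := by
  have h1 : (r + 1) ≠ 0 := by positivity
  obtain ⟨y, -, hy'⟩ := CompleteCone.exists_lub (fun n => (r + 1)⁻¹ • s n) (hs.smul _) (fun n => by
      rw [PositiveCone.nrm_smul, inv_mul_le_iff₀ (by positivity), mul_one]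
      exact (hr n).trans le_self_add)
  refine ⟨(r + 1) • y, ?_⟩
  have := hy'.smul h1
  simpa [smul_inv_smul₀ h1] using this

end Order

lemma coneLE_nnreal {x y : ℝ≥0} : ConeLE x y ↔ x ≤ y :=
  ⟨fun ⟨_, h⟩ => h ▸ le_self_add, fun h => ⟨y - x, add_tsub_cancel_of_le h⟩⟩

namespace ContLin

variable {P : Type u} {Q : Type v} [AddCommMonoid P] [Module ℝ≥0 P] [PositiveCone P]
  [AddCommMonoid Q] [Module ℝ≥0 Q]

instance : FunLike (ContLin P Q) P Q where
  coe f := f.toFun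
  coe_injective f g h := by
    obtain ⟨f, _⟩ := f
    obtain ⟨g, _⟩ := g
    congr
    exact LinearMap.ext fun x => congrFun h x

instance : LinearMapClass (ContLin P Q) ℝ≥0 P Q where
  map_add f := f.map_add'
  map_smulₛₗ f := f.map_smul'

@[ext] lemma ext {f g : ContLin P Q} (h : ∀ x, f x = g x) : f = g := DFunLike.ext _ _ h

@[simp] lemma coe_mk (f : P →ₗ[ℝ≥0] Q) (h) (x : P) : (⟨f, h⟩ : ContLin P Q) x = f x := rfl

@[simp] lemma toLinearMap_apply (f : ContLin P Q) (x : P) : f.toLinearMap x = f x := rfl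

lemma cont' (f : ContLin P Q) : IsScottCont f := f.cont

lemma monoLE (f : ContLin P Q) {x y : P} (h : ConeLE x y) : ConeLE (f x) (f y) :=
  h.map f.toLinearMap

lemma monoSeq (f : ContLin P Q) {s : ℕ → P} (h : IsMonoSeq s) : IsMonoSeq (fun n => f (s n)) :=
  h.map f.toLinearMap

lemma cont_of_bdd (f : ContLin P Q) {s : ℕ → P} {x : P} (hs : IsMonoSeq s) {r : ℝ≥0}
    (hr : ∀ n, nrm (s n) ≤ r) (hx : IsSeqLub s x) : IsSeqLub (fun n => f (s n)) (f x) :=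
  IsScottCont.of_bdd (f := f.toLinearMap) f.cont hs hr hx

/-- A linear and continuous map is bounded on the unit ball. -/
lemma bddAbove [CompleteCone P] [PositiveCone Q] (f : ContLin P Q) :
    BddAbove (Set.range fun x : {x : P // nrm x ≤ 1} => nrm (f x)) := by
  by_contra hcon
  have h : ∀ n : ℕ, ∃ x : P, nrm x ≤ 1 ∧ (4 : ℝ≥0) ^ n < nrm (f x) := by
    intro n
    by_contra! h'
    exact hcon ⟨4 ^ n, by rintro _ ⟨⟨x, hx⟩, rfl⟩; exact h' x hx⟩
  choose x hx hx' using h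
  let s : ℕ → P := fun n => ∑ k ∈ Finset.range n, ((1 / 2 : ℝ≥0) ^ (k + 1)) • x k
  have hstep : ∀ n, s (n + 1) = s n + ((1 / 2 : ℝ≥0) ^ (n + 1)) • x n := fun n =>
    Finset.sum_range_succ _ _
  have hs : IsMonoSeq s := by
    intro m n hmn
    induction n, hmn using Nat.le_induction with
    | base => exact ConeLE.refl _
    | succ n _ ih => exact ih.trans ⟨_, (hstep n).symm⟩
  have hnrm : ∀ n, nrm (s n) + (1 / 2 : ℝ≥0) ^ n ≤ 1 := by
    intro n
    induction n with
    | zero => simp [s, PositiveCone.nrm_zero]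
    | succ n ih =>
      have h1 : nrm (s (n + 1)) ≤ nrm (s n) + (1 / 2 : ℝ≥0) ^ (n + 1) := by
        rw [hstep]
        refine (PositiveCone.nrm_add_le _ _).trans ?_
        rw [PositiveCone.nrm_smul]
        gcongr
        exact (mul_le_mul_right (hx n) _).trans (mul_one _).le
      calc nrm (s (n + 1)) + (1 / 2 : ℝ≥0) ^ (n + 1)
          ≤ nrm (s n) + (1 / 2 : ℝ≥0) ^ (n + 1) + (1 / 2 : ℝ≥0) ^ (n + 1) := by gcongr
        _ = nrm (s n) + (1 / 2 : ℝ≥0) ^ n := by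
          rw [add_assoc, ← two_mul, pow_succ', ← mul_assoc]; norm_num
        _ ≤ 1 := ih
  obtain ⟨y, -, hy⟩ := CompleteCone.exists_lub s hs fun n => le_self_add.trans (hnrm n)
  have key : ∀ n : ℕ, (2 : ℝ≥0) ^ n ≤ 2 * nrm (f y) := by
    intro n
    have h1 : ConeLE (((1 / 2 : ℝ≥0) ^ (n + 1)) • x n) y :=
      ConeLE.trans ⟨s n, by rw [add_comm]; exact (hstep n).symm⟩ (hy.1 (n + 1))
    have h2 := (f.monoLE h1).nrm_le
    rw [map_smul, PositiveCone.nrm_smul] at h2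
    have h3 : (1 / 2 : ℝ≥0) ^ (n + 1) * 4 ^ n ≤ nrm (f y) :=
      (mul_le_mul_right (hx' n).le _).trans h2
    calc (2 : ℝ≥0) ^ n = 2 * ((1 / 2 : ℝ≥0) ^ (n + 1) * 4 ^ n) := by
          rw [pow_succ, show (4 : ℝ≥0) = 2 * 2 by norm_num, mul_pow]
          have : (1 / 2 : ℝ≥0) ^ n * 2 ^ n = 1 := by rw [← mul_pow]; norm_num
          calc (2 : ℝ≥0) ^ n = ((1 / 2 : ℝ≥0) ^ n * 2 ^ n) * 2 ^ n := by rw [this, one_mul]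
            _ = _ := by
              have h2 : (2 : ℝ≥0) * (1 / 2) = 1 := by norm_num
              calc _ = (2 : ℝ≥0) * (1 / 2) * ((1 / 2 : ℝ≥0) ^ n * 2 ^ n * 2 ^ n) := by
                    rw [h2, one_mul]
                _ = _ := by ring
      _ ≤ _ := by gcongr
  obtain ⟨n, hn⟩ := pow_unbounded_of_one_lt (2 * nrm (f y)) (one_lt_two (α := ℝ≥0))
  exact absurd (key n) (not_le.2 hn)

end ContLin

/-! ### The cone of linear and continuous maps -/

namespace ContLin

variable {P : Type u} {Q : Type v} [AddCommMonoid P] [Module ℝ≥0 P] [PositiveCone P]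
  [AddCommMonoid Q] [Module ℝ≥0 Q] [PositiveCone Q]

lemma isSeqLub_const (y : Q) : IsSeqLub (fun _ => y) y :=
  ⟨fun _ => ConeLE.refl _, fun _ h => h 0⟩

instance : Zero (ContLin P Q) := ⟨⟨0, fun _ _ _ _ _ => isSeqLub_const 0⟩⟩

instance : Add (ContLin P Q) :=
  ⟨fun f g => ⟨f.toLinearMap + g.toLinearMap, fun s x hs h1 hx =>
    IsSeqLub.add (f.monoSeq hs) (g.monoSeq hs) (f.cont s x hs h1 hx) (g.cont s x hs h1 hx)⟩⟩

instance : SMul ℝ≥0 (ContLin P Q) :=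
  ⟨fun r f => ⟨r • f.toLinearMap, fun s x hs h1 hx => by
    rcases eq_or_ne r 0 with rfl | hr
    · simpa using isSeqLub_const (0 : Q)
    · exact (f.cont s x hs h1 hx).smul hr⟩⟩

@[simp] lemma zero_apply (x : P) : (0 : ContLin P Q) x = 0 := rfl
@[simp] lemma add_apply (f g : ContLin P Q) (x : P) : (f + g) x = f x + g x := rfl
@[simp] lemma smul_apply (r : ℝ≥0) (f : ContLin P Q) (x : P) : (r • f) x = r • f x := rfl

instance : AddCommMonoid (ContLin P Q) where
  add_assoc _ _ _ := ext fun _ => add_assoc _ _ _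
  zero_add _ := ext fun _ => zero_add _
  add_zero _ := ext fun _ => add_zero _
  add_comm _ _ := ext fun _ => add_comm _ _
  nsmul := nsmulRec

instance : Module ℝ≥0 (ContLin P Q) where
  one_smul _ := ext fun _ => one_smul _ _
  mul_smul _ _ _ := ext fun _ => mul_smul _ _ _
  smul_zero _ := ext fun _ => smul_zero _
  smul_add _ _ _ := ext fun _ => smul_add _ _ _
  add_smul _ _ _ := ext fun _ => add_smul _ _ _
  zero_smul _ := ext fun _ => zero_smul _ _

/-- The operator norm. -/
noncomputable def opNrm (f : ContLin P Q) : ℝ≥0 := ⨆ x : {x : P // nrm x ≤ 1}, nrm (f x)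

lemma opNrm_le {f : ContLin P Q} {r : ℝ≥0} (h : ∀ x, nrm x ≤ 1 → nrm (f x) ≤ r) :
    f.opNrm ≤ r :=
  haveI : Nonempty {x : P // nrm x ≤ 1} := ⟨⟨0, by rw [PositiveCone.nrm_zero]; exact zero_le⟩⟩
  ciSup_le fun x => h x.1 x.2

variable [CompleteCone P]

lemma nrm_apply_le_opNrm (f : ContLin P Q) {x : P} (hx : nrm x ≤ 1) : nrm (f x) ≤ f.opNrm :=
  le_ciSup f.bddAbove (⟨x, hx⟩ : {x : P // nrm x ≤ 1})

lemma nrm_apply_le (f : ContLin P Q) (x : P) : nrm (f x) ≤ f.opNrm * nrm x := by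
  rcases eq_or_ne (nrm x) 0 with h | h
  · rw [PositiveCone.eq_zero_of_nrm_eq_zero x h, map_zero, PositiveCone.nrm_zero]
    exact zero_le
  · have := f.nrm_apply_le_opNrm (x := (nrm x)⁻¹ • x)
      (by rw [PositiveCone.nrm_smul, inv_mul_cancel₀ h])
    rwa [map_smul, PositiveCone.nrm_smul, inv_mul_le_iff₀ (pos_iff_ne_zero.2 h), mul_comm] at this

lemma nrm_apply_le_of_opNrm_le_one {f : ContLin P Q} (h : f.opNrm ≤ 1) (x : P) :
    nrm (f x) ≤ nrm x :=
  (f.nrm_apply_le x).trans ((mul_le_mul_left h _).trans (one_mul _).le)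

noncomputable instance : PositiveCone (ContLin P Q) where
  nrm := opNrm
  nrm_smul r f := by
    simp only [opNrm, smul_apply, PositiveCone.nrm_smul]
    exact (NNReal.mul_iSup _ _).symm
  nrm_add_le f g := opNrm_le fun x hx =>
    (PositiveCone.nrm_add_le _ _).trans
      (add_le_add (f.nrm_apply_le_opNrm hx) (g.nrm_apply_le_opNrm hx))
  eq_zero_of_nrm_eq_zero f hf := ext fun x => by
    have := f.nrm_apply_le x
    rw [hf, zero_mul] at this
    exact PositiveCone.eq_zero_of_nrm_eq_zero _ (le_antisymm this zero_le)
  cancel f g h H := ext fun x =>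
    PositiveCone.cancel _ _ (h x) (by rw [← add_apply, H, add_apply])
  nrm_le_nrm_add f g := opNrm_le fun x hx =>
    (PositiveCone.nrm_le_nrm_add (f x) (g x)).trans ((f + g).nrm_apply_le_opNrm hx)

/-- The algebraic order of the cone of linear and continuous maps is the pointwise order. -/
lemma coneLE_iff {f g : ContLin P Q} : ConeLE f g ↔ ∀ x, ConeLE (f x) (g x) := by
  constructor
  · rintro ⟨h, rfl⟩ x
    exact ⟨h x, rfl⟩
  · intro H
    choose d hd using H
    have hadd : ∀ x y, d (x + y) = d x + d y := fun x y => by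
      refine PositiveCone.cancel _ _ (f (x + y)) ?_
      rw [add_comm, hd, map_add, ← hd x, ← hd y, map_add]; abel
    have hsmul : ∀ (r : ℝ≥0) x, d (r • x) = r • d x := fun r x => by
      refine PositiveCone.cancel _ _ (f (r • x)) ?_
      rw [add_comm, hd, map_smul, ← hd x, map_smul, smul_add, add_comm]
    let D : P →ₗ[ℝ≥0] Q := { toFun := d, map_add' := hadd, map_smul' := hsmul }
    refine ⟨⟨D, fun s x hs h1 hx => ⟨fun n => (hx.1 n).map D, fun y hy => ?_⟩⟩, ext hd⟩
    have h2 : ConeLE (g x) (y + f x) := by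
      refine (g.cont s x hs h1 hx).2 _ fun n => ?_
      have h3 : ConeLE (f (s n) + d (s n)) (f x + y) := (f.monoLE (hx.1 n)).add (hy n)
      rw [hd, add_comm] at h3
      exact h3
    rw [← hd x, add_comm] at h2
    exact h2.of_add_le_add

lemma monoSeq_apply {s : ℕ → ContLin P Q} (hs : IsMonoSeq s) (x : P) :
    IsMonoSeq (fun n => s n x) := fun m n h => coneLE_iff.1 (hs m n h) x

/-- Pointwise lubs are lubs. -/
lemma isSeqLub_of_apply {s : ℕ → ContLin P Q} {f : ContLin P Q}
    (h : ∀ x, IsSeqLub (fun n => s n x) (f x)) : IsSeqLub s f :=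
  ⟨fun n => coneLE_iff.2 fun x => (h x).1 n,
    fun g hg => coneLE_iff.2 fun x => (h x).2 _ fun n => coneLE_iff.1 (hg n) x⟩

variable [CompleteCone Q]

lemma exists_pointwise_lub {s : ℕ → ContLin P Q} (hs : IsMonoSeq s)
    (h1 : ∀ n, nrm (s n) ≤ 1) :
    ∃ f : ContLin P Q, nrm f ≤ 1 ∧ ∀ x, IsSeqLub (fun n => s n x) (f x) := by
  have hb : ∀ x n, nrm (s n x) ≤ nrm x := fun x n => nrm_apply_le_of_opNrm_le_one (h1 n) x
  choose d hd using fun x => CompleteCone.exists_lub_of_bdd (monoSeq_apply hs x) (hb x)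
  have hadd : ∀ x y, d (x + y) = d x + d y := fun x y => by
    refine (hd (x + y)).unique ?_
    have := (hd x).add (monoSeq_apply hs x) (monoSeq_apply hs y) (hd y)
    simpa only [map_add] using this
  have hsmul : ∀ (r : ℝ≥0) x, d (r • x) = r • d x := fun r x => by
    refine (hd (r • x)).unique ?_
    rcases eq_or_ne r 0 with rfl | hr
    · simpa using isSeqLub_const (0 : Q)
    · simpa only [map_smul] using (hd x).smul hr
  let D : P →ₗ[ℝ≥0] Q := { toFun := d, map_add' := hadd, map_smul' := hsmul }
  refine ⟨⟨D, fun t x ht ht1 hx => ⟨fun n => (hx.1 n).map D, fun y hy => ?_⟩⟩, ?_, hd⟩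
  · refine (hd x).2 y fun n => ((s n).cont t x ht ht1 hx).2 y fun k => ?_
    exact ((hd (t k)).1 n).trans (hy k)
  · exact opNrm_le fun x hx => ((hd x).nrm_le (monoSeq_apply hs x) (hb x)).trans hx

instance : CompleteCone (ContLin P Q) where
  exists_lub s hs h1 := by
    obtain ⟨f, hf, hf'⟩ := exists_pointwise_lub hs h1
    exact ⟨f, hf, isSeqLub_of_apply hf'⟩

/-- Lubs of monotone sequences of the unit ball are computed pointwise. -/
lemma isSeqLub_apply {s : ℕ → ContLin P Q} (hs : IsMonoSeq s) (h1 : ∀ n, nrm (s n) ≤ 1)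
    {f : ContLin P Q} (hf : IsSeqLub s f) (x : P) : IsSeqLub (fun n => s n x) (f x) := by
  obtain ⟨g, -, hg⟩ := exists_pointwise_lub hs h1
  rw [hf.unique (isSeqLub_of_apply hg)]
  exact hg x

/-- Evaluation at a point followed by a linear and continuous map. -/
def evalComp {R : Type w} [AddCommMonoid R] [Module ℝ≥0 R] (g : ContLin Q R) (x : P) :
    ContLin (ContLin P Q) R where
  toFun f := g (f x)
  map_add' _ _ := map_add g _ _
  map_smul' _ _ := map_smul g _ _
  cont s f hs h1 hf := g.cont_of_bdd (monoSeq_apply hs x)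
    (fun n => nrm_apply_le_of_opNrm_le_one (h1 n) x) (isSeqLub_apply hs h1 hf x)

instance [SeparatedCone Q] : SeparatedCone (ContLin P Q) where
  sep f g h := ext fun x => SeparatedCone.sep _ _ fun y' => h (evalComp y' x)

end ContLin

namespace ContLin

variable {P : Type u} {Q : Type v} {R : Type w} [AddCommMonoid P] [Module ℝ≥0 P]
  [PositiveCone P] [AddCommMonoid Q] [Module ℝ≥0 Q] [PositiveCone Q]
  [AddCommMonoid R] [Module ℝ≥0 R]

/-- The identity map. -/
def id : ContLin P P := ⟨LinearMap.id, fun _ _ _ _ h => h⟩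

/-- Composition. -/
def comp [CompleteCone P] (g : ContLin Q R) (f : ContLin P Q) : ContLin P R :=
  ⟨g.toLinearMap.comp f.toLinearMap, fun s x hs h1 hx =>
    g.cont_of_bdd (f.monoSeq hs) (fun n => f.nrm_apply_le_opNrm (h1 n)) (f.cont s x hs h1 hx)⟩

@[simp] lemma id_apply (x : P) : (id : ContLin P P) x = x := rfl

@[simp] lemma comp_apply [CompleteCone P] (g : ContLin Q R) (f : ContLin P Q) (x : P) :
    (comp g f) x = g (f x) := rfl

end ContLin

/-! ### The category of separated complete positive cones -/

/-- Objects: separated complete positive cones. -/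
structure SCCLin : Type (u + 1) where
  /-- the underlying type -/
  carrier : Type u
  [addCommMonoid : AddCommMonoid carrier]
  [module : Module ℝ≥0 carrier]
  [positiveCone : PositiveCone carrier]
  [completeCone : CompleteCone carrier]
  [separatedCone : SeparatedCone carrier]

namespace SCCLin

instance : CoeSort SCCLin.{u} (Type u) := ⟨SCCLin.carrier⟩

attribute [instance] addCommMonoid module positiveCone completeCone separatedCone

/-- Morphisms: linear and continuous maps which map the unit ball to the unit ball. -/
structure Hom (P Q : SCCLin.{u}) : Type u where
  /-- the underlying linear and continuous map -/
  toContLin : ContLin P Q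
  nrm_le_one : ∀ x, nrm x ≤ 1 → nrm (toContLin x) ≤ 1

namespace Hom

variable {P Q : SCCLin.{u}}

instance : FunLike (Hom P Q) P Q where
  coe f := f.toContLin
  coe_injective f g h := by
    obtain ⟨f, _⟩ := f
    obtain ⟨g, _⟩ := g
    congr
    exact DFunLike.coe_injective h

instance : LinearMapClass (Hom P Q) ℝ≥0 P Q where
  map_add f := map_add f.toContLin
  map_smulₛₗ f := map_smulₛₗ f.toContLin

lemma ext {f g : Hom P Q} (h : ∀ x, f x = g x) : f = g := DFunLike.ext _ _ h

lemma opNrm_le_one (f : Hom P Q) : nrm f.toContLin ≤ 1 := ContLin.opNrm_le f.nrm_le_one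

lemma nrm_le (f : Hom P Q) (x : P) : nrm (f x) ≤ nrm x :=
  ContLin.nrm_apply_le_of_opNrm_le_one f.opNrm_le_one x

end Hom

instance : Category SCCLin.{u} where
  Hom := Hom
  id P := ⟨ContLin.id, fun _ h => h⟩
  comp f g := ⟨g.toContLin.comp f.toContLin, fun x hx => g.nrm_le_one _ (f.nrm_le_one x hx)⟩

instance : ConcreteCategory SCCLin.{u} Hom where
  hom f := f
  ofHom f := f

@[ext] lemma hom_ext {P Q : SCCLin.{u}} {f g : P ⟶ Q} (h : ∀ x : P, f x = g x) : f = g :=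
  Hom.ext h

/-- The cone `ℝ≥0`, lifted to the ambient universe and normed by the identity. -/
instance : PositiveCone (ULift.{u} ℝ≥0) where
  nrm x := x.down
  nrm_smul _ _ := rfl
  nrm_add_le _ _ := le_rfl
  eq_zero_of_nrm_eq_zero x h := ULift.ext _ _ h
  cancel x y z h := ULift.ext _ _ (add_right_cancel (congrArg ULift.down h))
  nrm_le_nrm_add _ _ := le_self_add

lemma coneLE_ulift {x y : ULift.{u} ℝ≥0} : ConeLE x y ↔ x.down ≤ y.down :=
  ⟨fun ⟨_, h⟩ => h ▸ le_self_add,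
    fun h => ⟨⟨y.down - x.down⟩, ULift.ext _ _ (add_tsub_cancel_of_le h)⟩⟩

instance : CompleteCone (ULift.{u} ℝ≥0) where
  exists_lub s hs h1 := by
    have hb : BddAbove (Set.range fun n => (s n).down) := ⟨1, by rintro _ ⟨n, rfl⟩; exact h1 n⟩
    refine ⟨⟨⨆ n, (s n).down⟩, ciSup_le h1, fun n => coneLE_ulift.2 (le_ciSup hb n), fun y hy => ?_⟩
    exact coneLE_ulift.2 (ciSup_le fun n => coneLE_ulift.1 (hy n))

instance : SeparatedCone (ULift.{u} ℝ≥0) where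
  sep x y h := ULift.ext _ _ <| h
    { toFun := ULift.down
      map_add' := fun _ _ => rfl
      map_smul' := fun _ _ => rfl
      cont := fun s x hs h1 hx => by
        refine ⟨fun n => coneLE_nnreal.2 (coneLE_ulift.1 (hx.1 n)), fun y hy => ?_⟩
        exact coneLE_nnreal.2 (coneLE_ulift.1 (hx.2 ⟨y⟩ fun n =>
          coneLE_ulift.2 (coneLE_nnreal.1 (hy n)))) }

/-- The unit object `ℝ≥0`. -/
def unit : SCCLin.{u} := ⟨ULift.{u} ℝ≥0⟩

/-- The element of the unit object given by a nonnegative real number. -/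
def scalar (r : ℝ≥0) : (unit.{u} : SCCLin.{u}) := ULift.up r

/-- The internal hom `P ⊸ Q`: the cone of linear and continuous maps from `P` to `Q`. -/
noncomputable def linHom (P Q : SCCLin.{u}) : SCCLin.{u} := ⟨ContLin P Q⟩

noncomputable instance (P Q : SCCLin.{u}) : FunLike (linHom P Q) P Q :=
  inferInstanceAs (FunLike (ContLin P Q) P Q)

/-- The functorial action `f ⊸ g : h ↦ g ∘ h ∘ f` of the internal hom. -/
noncomputable def linHomMap {P P' Q Q' : SCCLin.{u}} (f : P' ⟶ P) (g : Q ⟶ Q') :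
    linHom P Q ⟶ linHom P' Q' :=
  Hom.mk (P := linHom P Q) (Q := linHom P' Q')
    { toFun := fun h : ContLin P Q =>
        ((Hom.toContLin g).comp (h.comp (Hom.toContLin f)) : ContLin P' Q')
      map_add' := fun _ _ => ContLin.ext fun _ => map_add (Hom.toContLin g) _ _
      map_smul' := fun _ _ => ContLin.ext fun _ => map_smul (Hom.toContLin g) _ _
      cont := fun s h hs h1 hh => ContLin.isSeqLub_of_apply fun x =>
        (Hom.toContLin g).cont_of_bdd (ContLin.monoSeq_apply hs _)
          (fun n => ContLin.nrm_apply_le_of_opNrm_le_one (h1 n) _)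
          (ContLin.isSeqLub_apply hs h1 hh _) }
    (fun h hh => ContLin.opNrm_le fun x hx =>
      g.nrm_le_one _ (((ContLin.nrm_apply_le_of_opNrm_le_one hh _).trans (f.nrm_le x)).trans hx))

/-- The bifunctor `(P, Q) ↦ (P ⊸ Q)`. -/
noncomputable def linHomFunctor : SCCLin.{u}ᵒᵖ ⥤ SCCLin.{u} ⥤ SCCLin.{u} where
  obj P :=
    { obj := fun Q => linHom P.unop Q
      map := fun g => linHomMap (𝟙 P.unop) g }
  map f := { app := fun Q => linHomMap f.unop (𝟙 Q) }

/-- Bilinear and separately continuous maps `P × Q → R` which map the product of the unit balls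
to the unit ball. -/
structure Bilin (P Q R : SCCLin.{u}) : Type u where
  /-- the underlying function -/
  toFun : P → Q → R
  add_left : ∀ x x' y, toFun (x + x') y = toFun x y + toFun x' y
  smul_left : ∀ (r : ℝ≥0) x y, toFun (r • x) y = r • toFun x y
  add_right : ∀ x y y', toFun x (y + y') = toFun x y + toFun x y'
  smul_right : ∀ (r : ℝ≥0) x y, toFun x (r • y) = r • toFun x y
  cont_left : ∀ y, IsScottCont fun x => toFun x y
  cont_right : ∀ x, IsScottCont fun y => toFun x y
  nrm_le_one : ∀ x y, nrm x ≤ 1 → nrm y ≤ 1 → nrm (toFun x y) ≤ 1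

instance (P Q R : SCCLin.{u}) : CoeFun (Bilin P Q R) (fun _ => P → Q → R) := ⟨Bilin.toFun⟩

/-- The morphism `P ⟶ (Q ⊸ R)` associated with a bilinear map. -/
noncomputable def Bilin.transpose {P Q R : SCCLin.{u}} (b : Bilin P Q R) : P ⟶ linHom Q R :=
  Hom.mk (Q := linHom Q R)
    { toFun := fun x => (⟨⟨⟨b x, b.add_right x⟩, fun r => b.smul_right r x⟩, b.cont_right x⟩ :
        ContLin Q R)
      map_add' := fun x x' => ContLin.ext fun y => b.add_left x x' y
      map_smul' := fun r x => ContLin.ext fun y => b.smul_left r x y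
      cont := fun s x hs h1 hx => ContLin.isSeqLub_of_apply fun y => b.cont_left y s x hs h1 hx }
    (fun x hx => ContLin.opNrm_le fun y hy => b.nrm_le_one x y hx hy)

/-- The bilinear map `(f, x) ↦ f x`. -/
noncomputable def evalBilin (P Q : SCCLin.{u}) : Bilin (linHom P Q) P Q where
  toFun f x := f x
  add_left _ _ _ := rfl
  smul_left _ _ _ := rfl
  add_right f := map_add (F := ContLin P Q) f
  smul_right r f x := map_smul (F := ContLin P Q) f r x
  cont_left x _ _ hs h1 hf := ContLin.isSeqLub_apply hs h1 hf x
  cont_right f := ContLin.cont' f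
  nrm_le_one _ _ hf hx := (ContLin.nrm_apply_le_of_opNrm_le_one hf _).trans hx

end SCCLin

/-! ### Probabilistic coherence spaces -/

/-- The pairing `⟨u, u'⟩ = ∑ a, u a * u' a`, with values in `[0, ∞]`. -/
noncomputable def pcsPairing {I : Type u} (x x' : I → ℝ≥0) : ℝ≥0∞ :=
  ∑' a, (x a : ℝ≥0∞) * (x' a : ℝ≥0∞)

/-- The polar of a set of families of nonnegative real numbers. -/
def pcsOrth {I : Type u} (U : Set (I → ℝ≥0)) : Set (I → ℝ≥0) :=
  {x' | ∀ x ∈ U, pcsPairing x x' ≤ 1}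

section Pairing

variable {I : Type u}

lemma pcsPairing_comm (x y : I → ℝ≥0) : pcsPairing x y = pcsPairing y x := by
  simp only [pcsPairing, mul_comm]

lemma pcsPairing_add (x y z : I → ℝ≥0) :
    pcsPairing (x + y) z = pcsPairing x z + pcsPairing y z := by
  simp only [pcsPairing, Pi.add_apply, ENNReal.coe_add, add_mul, ENNReal.tsum_add]

lemma pcsPairing_smul (r : ℝ≥0) (x z : I → ℝ≥0) :
    pcsPairing (r • x) z = r * pcsPairing x z := by
  simp only [pcsPairing, Pi.smul_apply, smul_eq_mul, ENNReal.coe_mul, mul_assoc,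
    ENNReal.tsum_mul_left]

lemma pcsPairing_mono {x y : I → ℝ≥0} (h : ∀ a, x a ≤ y a) (z : I → ℝ≥0) :
    pcsPairing x z ≤ pcsPairing y z := by
  unfold pcsPairing
  gcongr with a
  exact h a

lemma pcsPairing_single [DecidableEq I] (a : I) (r : ℝ≥0) (x : I → ℝ≥0) :
    pcsPairing x (Pi.single a r) = x a * r := by
  unfold pcsPairing
  rw [tsum_eq_single a fun b hb => by simp [Pi.single_eq_of_ne hb]]
  simp

/-- Monotone convergence for weighted sums. -/
lemma tsum_le_of_isLUB {s : ℕ → I → ℝ≥0} (hs : ∀ a m n, m ≤ n → s m a ≤ s n a) {x : I → ℝ≥0}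
    (hx : ∀ a, IsLUB (Set.range fun n => s n a) (x a)) (w : I → ℝ≥0) {c : ℝ≥0∞}
    (h : ∀ n, ∑' a, (w a : ℝ≥0∞) * (s n a : ℝ≥0∞) ≤ c) :
    ∑' a, (w a : ℝ≥0∞) * (x a : ℝ≥0∞) ≤ c := by
  rw [ENNReal.tsum_eq_iSup_sum]
  refine iSup_le fun F => ?_
  have hxa : ∀ a, (x a : ℝ≥0∞) = ⨆ n, (s n a : ℝ≥0∞) := fun a => by
    rw [← ENNReal.coe_iSup (hx a).bddAbove, (hx a).csSup_eq (Set.range_nonempty _) |>.symm]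
    rfl
  simp only [hxa, ENNReal.mul_iSup]
  rw [ENNReal.finsetSum_iSup_of_monotone]
  · exact iSup_le fun n => (ENNReal.sum_le_tsum F).trans (h n)
  · intro a m n hmn
    have := hs a m n hmn
    dsimp only
    gcongr

lemma subset_pcsOrth_pcsOrth (U : Set (I → ℝ≥0)) : U ⊆ pcsOrth (pcsOrth U) :=
  fun x hx x' hx' => by rw [pcsPairing_comm]; exact hx' x hx

lemma pcsOrth_anti {U V : Set (I → ℝ≥0)} (h : U ⊆ V) : pcsOrth V ⊆ pcsOrth U :=
  fun _ hx' x hx => hx' x (h hx)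

lemma pcsOrth_pcsOrth_pcsOrth (U : Set (I → ℝ≥0)) :
    pcsOrth (pcsOrth (pcsOrth U)) = pcsOrth U :=
  Set.Subset.antisymm (pcsOrth_anti (subset_pcsOrth_pcsOrth U)) (subset_pcsOrth_pcsOrth _)

end Pairing

/-- Probabilistic coherence spaces. -/
structure PCS : Type (u + 1) where
  /-- the web -/
  web : Type u
  [countable_web : Countable web]
  /-- the set of cliques -/
  coh : Set (web → ℝ≥0)
  biorth : pcsOrth (pcsOrth coh) = coh
  pos : ∀ a, ∃ x ∈ coh, 0 < x a
  bdd : ∀ a, BddAbove {r | ∃ x ∈ coh, x a = r}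

namespace PCS

/-- The norm, with values in `[0, ∞]`, of a family of nonnegative real numbers. -/
noncomputable def enrm (X : PCS.{u}) (x : X.web → ℝ≥0) : ℝ≥0∞ :=
  ⨆ x' ∈ pcsOrth X.coh, pcsPairing x x'

variable {X : PCS.{u}}

lemma mem_coh_iff {x : X.web → ℝ≥0} : x ∈ X.coh ↔ X.enrm x ≤ 1 := by
  conv_lhs => rw [← X.biorth]
  simp only [enrm, iSup_le_iff, pcsPairing_comm x]
  rfl

lemma enrm_mono {x y : X.web → ℝ≥0} (h : ∀ a, x a ≤ y a) : X.enrm x ≤ X.enrm y :=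
  iSup₂_mono fun z _ => pcsPairing_mono h z

lemma enrm_add_le (x y : X.web → ℝ≥0) : X.enrm (x + y) ≤ X.enrm x + X.enrm y :=
  iSup₂_le fun z hz => by
    rw [pcsPairing_add]
    exact add_le_add (le_iSup₂_of_le z hz le_rfl) (le_iSup₂_of_le z hz le_rfl)

lemma enrm_smul (r : ℝ≥0) (x : X.web → ℝ≥0) : X.enrm (r • x) = r * X.enrm x := by
  simp only [enrm, pcsPairing_smul, ENNReal.mul_iSup]

lemma exists_smul_mem_iff {x : X.web → ℝ≥0} :
    (∃ r : ℝ≥0, 0 < r ∧ r • x ∈ X.coh) ↔ X.enrm x ≠ ⊤ := by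
  constructor
  · rintro ⟨r, hr, h⟩ htop
    rw [mem_coh_iff, enrm_smul, htop, ENNReal.mul_top (by simpa using hr.ne')] at h
    simp at h
  · intro h
    obtain ⟨M, hM⟩ := WithTop.ne_top_iff_exists.1 h
    refine ⟨(M + 1)⁻¹, by positivity, ?_⟩
    rw [mem_coh_iff, enrm_smul, ← hM]
    change ((M + 1)⁻¹ : ℝ≥0) * (M : ℝ≥0∞) ≤ 1
    rw [← ENNReal.coe_mul, ENNReal.coe_le_one_iff,
      inv_mul_le_iff₀ (by positivity), mul_one]
    exact le_self_add

/-- The families `x` such that `r • x` is a clique for some `r > 0`. -/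
def coneSubmodule (X : PCS.{u}) : Submodule ℝ≥0 (X.web → ℝ≥0) where
  carrier := {x | ∃ r : ℝ≥0, 0 < r ∧ r • x ∈ X.coh}
  add_mem' {x y} hx hy := by
    simp only [Set.mem_ofPred_eq, exists_smul_mem_iff] at hx hy ⊢
    exact ne_top_of_le_ne_top (ENNReal.add_ne_top.2 ⟨hx, hy⟩) (enrm_add_le x y)
  zero_mem' := by
    refine exists_smul_mem_iff.2 ?_
    simp [enrm, pcsPairing]
  smul_mem' r x hx := by
    simp only [Set.mem_ofPred_eq, exists_smul_mem_iff] at hx ⊢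
    rw [enrm_smul]
    exact ENNReal.mul_ne_top ENNReal.coe_ne_top hx

lemma mem_cone_iff {x : X.web → ℝ≥0} : x ∈ X.coneSubmodule ↔ X.enrm x ≠ ⊤ := exists_smul_mem_iff

lemma exists_pos_single_mem_orth [DecidableEq X.web] (a : X.web) :
    ∃ r : ℝ≥0, 0 < r ∧ Pi.single a r ∈ pcsOrth X.coh := by
  obtain ⟨M, hM⟩ := X.bdd a
  refine ⟨(M + 1)⁻¹, by positivity, fun x hx => ?_⟩
  rw [pcsPairing_single, ← ENNReal.coe_mul, ENNReal.coe_le_one_iff, mul_comm,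
    inv_mul_le_iff₀ (by positivity), mul_one]
  exact (hM ⟨x, hx, rfl⟩).trans le_self_add

lemma coneLE_iff {x y : X.coneSubmodule} : ConeLE x y ↔ ∀ a, x.1 a ≤ y.1 a := by
  constructor
  · rintro ⟨z, rfl⟩ a
    exact le_self_add
  · intro h
    refine ⟨⟨fun a => y.1 a - x.1 a, ?_⟩, ?_⟩
    · rw [mem_cone_iff]
      exact ne_top_of_le_ne_top (mem_cone_iff.1 y.2) (enrm_mono fun a => tsub_le_self)
    · exact Subtype.ext (funext fun a => add_tsub_cancel_of_le (h a))

noncomputable instance : PositiveCone X.coneSubmodule where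
  nrm x := (X.enrm x.1).toNNReal
  nrm_smul r x := by
    change (X.enrm (r • x.1)).toNNReal = _
    rw [enrm_smul, ENNReal.toNNReal_mul, ENNReal.toNNReal_coe]
  nrm_add_le x y := by
    have hx := mem_cone_iff.1 x.2
    have hy := mem_cone_iff.1 y.2
    rw [← ENNReal.toNNReal_add hx hy]
    exact ENNReal.toNNReal_mono (ENNReal.add_ne_top.2 ⟨hx, hy⟩) (enrm_add_le _ _)
  eq_zero_of_nrm_eq_zero x h := by
    classical
    have h0 : X.enrm x.1 = 0 := by
      rcases (ENNReal.toNNReal_eq_zero_iff _).1 h with h | h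
      · exact h
      · exact absurd h (mem_cone_iff.1 x.2)
    refine Subtype.ext (funext fun a => ?_)
    obtain ⟨r, hr, hra⟩ := X.exists_pos_single_mem_orth a
    have h1 : pcsPairing x.1 (Pi.single a r) ≤ 0 := h0 ▸ le_iSup₂_of_le _ hra le_rfl
    rw [pcsPairing_single, nonpos_iff_eq_zero, mul_eq_zero] at h1
    rcases h1 with h1 | h1
    · exact_mod_cast h1
    · exact absurd (ENNReal.coe_eq_zero.1 h1) hr.ne'
  cancel x y z h := Subtype.ext (funext fun a =>
    add_right_cancel (congrFun (congrArg Subtype.val h) a))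
  nrm_le_nrm_add x y := ENNReal.toNNReal_mono (mem_cone_iff.1 (x + y).2)
    (enrm_mono fun a => le_self_add)

/-- The unit ball is the set of cliques. -/
lemma nrm_le_one_iff {x : X.coneSubmodule} : nrm x ≤ 1 ↔ x.1 ∈ X.coh := by
  have h : nrm x = (X.enrm x.1).toNNReal := rfl
  rw [mem_coh_iff, h, ← ENNReal.coe_le_one_iff, ENNReal.coe_toNNReal (mem_cone_iff.1 x.2)]

lemma exists_pointwise_lub {s : ℕ → X.coneSubmodule} (hs : IsMonoSeq s)
    (h1 : ∀ n, nrm (s n) ≤ 1) :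
    ∃ x : X.coneSubmodule, nrm x ≤ 1 ∧ ∀ a, IsLUB (Set.range fun n => (s n).1 a) (x.1 a) := by
  have hb : ∀ a, BddAbove (Set.range fun n => (s n).1 a) := fun a => by
    obtain ⟨M, hM⟩ := X.bdd a
    exact ⟨M, by rintro _ ⟨n, rfl⟩; exact hM ⟨_, nrm_le_one_iff.1 (h1 n), rfl⟩⟩
  have hlub : ∀ a, IsLUB (Set.range fun n => (s n).1 a) (⨆ n, (s n).1 a) :=
    fun a => isLUB_ciSup (hb a)
  have hmem : (fun a => ⨆ n, (s n).1 a) ∈ X.coh := by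
    rw [← X.biorth]
    intro x' hx'
    refine tsum_le_of_isLUB (s := fun n => (s n).1) (fun a m n h => coneLE_iff.1 (hs m n h) a)
      hlub x' fun n => ?_
    have := hx' _ (nrm_le_one_iff.1 (h1 n))
    rwa [pcsPairing_comm] at this
  exact ⟨⟨_, 1, one_pos, by rwa [one_smul]⟩, nrm_le_one_iff.2 hmem, hlub⟩

lemma isSeqLub_of_isLUB {s : ℕ → X.coneSubmodule} {x : X.coneSubmodule}
    (h : ∀ a, IsLUB (Set.range fun n => (s n).1 a) (x.1 a)) : IsSeqLub s x :=
  ⟨fun n => coneLE_iff.2 fun a => (h a).1 ⟨n, rfl⟩, fun y hy => coneLE_iff.2 fun a =>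
    (h a).2 (by rintro _ ⟨n, rfl⟩; exact coneLE_iff.1 (hy n) a)⟩

instance : CompleteCone X.coneSubmodule where
  exists_lub s hs h1 := by
    obtain ⟨x, hx, hx'⟩ := exists_pointwise_lub hs h1
    exact ⟨x, hx, isSeqLub_of_isLUB hx'⟩

lemma isLUB_apply {s : ℕ → X.coneSubmodule} (hs : IsMonoSeq s) (h1 : ∀ n, nrm (s n) ≤ 1)
    {x : X.coneSubmodule} (hx : IsSeqLub s x) (a : X.web) :
    IsLUB (Set.range fun n => (s n).1 a) (x.1 a) := by
  obtain ⟨y, -, hy⟩ := exists_pointwise_lub hs h1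
  rw [hx.unique (isSeqLub_of_isLUB hy)]
  exact hy a

instance : SeparatedCone X.coneSubmodule where
  sep x y h := Subtype.ext (funext fun a => h
    { toFun := fun z => z.1 a
      map_add' := fun _ _ => rfl
      map_smul' := fun _ _ => rfl
      cont := fun s z hs h1 hz => by
        have := isLUB_apply hs h1 hz a
        exact ⟨fun n => coneLE_nnreal.2 (this.1 ⟨n, rfl⟩), fun r hr => coneLE_nnreal.2
          (this.2 (by rintro _ ⟨n, rfl⟩; exact coneLE_nnreal.1 (hr n)))⟩ })

/-- The cone `Cl X` associated with a probabilistic coherence space. -/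
noncomputable def Cl (X : PCS.{u}) : SCCLin.{u} := ⟨X.coneSubmodule⟩

/-- Matrix application `(t · x) b = ∑ a, t a b * x a`, with values in `[0, ∞]`. -/
noncomputable def matApp {I J : Type u} (t : I → J → ℝ≥0) (x : I → ℝ≥0) (b : J) : ℝ≥0∞ :=
  ∑' a, (t a b : ℝ≥0∞) * (x a : ℝ≥0∞)

/-- Morphisms of probabilistic coherence spaces: matrices which map cliques to cliques. -/
structure Hom (X Y : PCS.{u}) where
  /-- the matrix -/
  mat : X.web → Y.web → ℝ≥0
  map_coh : ∀ x ∈ X.coh, ∃ y ∈ Y.coh, ∀ b, matApp mat x b = (y b : ℝ≥0∞)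

section MatApp

variable {I J : Type u}

lemma matApp_add (t : I → J → ℝ≥0) (x y : I → ℝ≥0) (b : J) :
    matApp t (x + y) b = matApp t x b + matApp t y b := by
  simp only [matApp, Pi.add_apply, ENNReal.coe_add, mul_add, ENNReal.tsum_add]

lemma matApp_smul (t : I → J → ℝ≥0) (r : ℝ≥0) (x : I → ℝ≥0) (b : J) :
    matApp t (r • x) b = r * matApp t x b := by
  simp only [matApp, Pi.smul_apply, smul_eq_mul, ENNReal.coe_mul, mul_left_comm _ (r : ℝ≥0∞),
    ENNReal.tsum_mul_left]

lemma matApp_mono (t : I → J → ℝ≥0) {x y : I → ℝ≥0} (h : ∀ a, x a ≤ y a) (b : J) :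
    matApp t x b ≤ matApp t y b := by
  unfold matApp
  gcongr with a
  exact h a

end MatApp

variable {Y : PCS.{u}}

lemma Hom.matApp_ne_top (t : Hom X Y) {x : X.web → ℝ≥0} (hx : x ∈ X.coneSubmodule) (b : Y.web) :
    matApp t.mat x b ≠ ⊤ := by
  obtain ⟨r, hr, h⟩ := hx
  obtain ⟨y, -, hy⟩ := t.map_coh _ h
  intro htop
  have := hy b
  rw [matApp_smul, htop, ENNReal.mul_top (by simpa using hr.ne')] at this
  exact ENNReal.coe_ne_top this.symm

lemma Hom.toNNReal_matApp_mem (t : Hom X Y) {x : X.web → ℝ≥0} (hx : x ∈ X.coh) :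
    (fun b => (matApp t.mat x b).toNNReal) ∈ Y.coh := by
  obtain ⟨y, hy, h⟩ := t.map_coh x hx
  simp only [h, ENNReal.toNNReal_coe]
  exact hy

/-- The linear and continuous map `Cl t : x ↦ t · x` associated with a matrix `t`. -/
noncomputable def Hom.toCl (t : Hom X Y) : Cl X ⟶ Cl Y :=
  SCCLin.Hom.mk (P := Cl X) (Q := Cl Y)
    { toFun := fun x : X.coneSubmodule => (⟨fun b => (matApp t.mat x.1 b).toNNReal, by
        obtain ⟨r, hr, h⟩ := x.2
        refine ⟨r, hr, ?_⟩
        have := t.toNNReal_matApp_mem h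
        simp only [matApp_smul, ENNReal.toNNReal_mul, ENNReal.toNNReal_coe] at this
        exact this⟩ : Y.coneSubmodule)
      map_add' := fun x y => Subtype.ext (funext fun b => by
        change (matApp t.mat (x.1 + y.1) b).toNNReal = _
        rw [matApp_add, ENNReal.toNNReal_add (t.matApp_ne_top x.2 b) (t.matApp_ne_top y.2 b)]
        rfl)
      map_smul' := fun r x => Subtype.ext (funext fun b => by
        change (matApp t.mat (r • x.1) b).toNNReal = _
        rw [matApp_smul, ENNReal.toNNReal_mul, ENNReal.toNNReal_coe]
        rfl)
      cont := fun s x hs h1 hx => isSeqLub_of_isLUB fun b => by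
        refine ⟨?_, fun c hc => ?_⟩
        · rintro _ ⟨n, rfl⟩
          exact ENNReal.toNNReal_mono (t.matApp_ne_top x.2 b)
            (matApp_mono _ (coneLE_iff.1 (hx.1 n)) b)
        · rw [← ENNReal.toNNReal_coe c]
          refine ENNReal.toNNReal_mono ENNReal.coe_ne_top ?_
          refine tsum_le_of_isLUB (s := fun n => (s n).1)
            (fun a m n h => coneLE_iff.1 (hs m n h) a) (isLUB_apply hs h1 hx) _ fun n => ?_
          have : (matApp t.mat (s n).1 b).toNNReal ≤ c := hc ⟨n, rfl⟩
          rw [← ENNReal.coe_le_coe, ENNReal.coe_toNNReal (t.matApp_ne_top (s n).2 b)] at this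
          exact this }
    (fun x hx => nrm_le_one_iff.2 (t.toNNReal_matApp_mem (nrm_le_one_iff.1 hx)))

/-- The permutation matrix of a bijection of webs which maps cliques to cliques. -/
noncomputable def Hom.ofEquiv (e : X.web ≃ Y.web) (h : ∀ x ∈ X.coh, (fun b => x (e.symm b)) ∈ Y.coh) :
    Hom X Y where
  mat a b := by classical exact if e a = b then 1 else 0
  map_coh x hx := by
    refine ⟨_, h x hx, fun b => ?_⟩
    unfold matApp
    rw [tsum_eq_single (e.symm b)]
    · simp
    · intro a ha
      have : e a ≠ b := fun hab => ha (by rw [← hab, e.symm_apply_apply])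
      simp [this]

/-- The probabilistic coherence space on `I` whose cliques are the families bounded by `1`. -/
def cube (I : Type u) [Countable I] : PCS.{u} where
  web := I
  coh := {x | ∀ a, x a ≤ 1}
  biorth := by
    classical
    refine Set.Subset.antisymm (fun x hx a => ?_) (subset_pcsOrth_pcsOrth _)
    have := hx (Pi.single a 1) fun y hy => by
      rw [pcsPairing_single]
      simpa using hy a
    rw [pcsPairing_comm, pcsPairing_single] at this
    simpa using this
  pos a := ⟨fun _ => 1, fun _ => le_rfl, one_pos⟩
  bdd a := ⟨1, by rintro _ ⟨x, hx, rfl⟩; exact hx a⟩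

/-- The objects of the dense subcategory: those whose cliques are all the families bounded
by `1`. -/
def IsCube (X : PCS.{u}) : Prop := X.coh = {x | ∀ a, x a ≤ 1}

/-- The unit of the tensor product of probabilistic coherence spaces. -/
def one : PCS.{u} := cube PUnit.{u + 1}

/-- The family `(x ⊗ y) (a, b) = x a * y b`. -/
def pureTensor {I J : Type u} (x : I → ℝ≥0) (y : J → ℝ≥0) : I × J → ℝ≥0 :=
  fun p => x p.1 * y p.2

/-- The tensors of elements of `U` and `V`. -/
def pureTensors {I J : Type u} (U : Set (I → ℝ≥0)) (V : Set (J → ℝ≥0)) : Set (I × J → ℝ≥0) :=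
  {z | ∃ x ∈ U, ∃ y ∈ V, z = pureTensor x y}

/-- The tensor product of probabilistic coherence spaces: the cliques are the bipolar of the set
of tensors of cliques. -/
def tensor (X Y : PCS.{u}) : PCS.{u} where
  web := X.web × Y.web
  countable_web := @instCountableProd _ _ X.countable_web Y.countable_web
  coh := pcsOrth (pcsOrth (pureTensors X.coh Y.coh))
  biorth := pcsOrth_pcsOrth_pcsOrth _
  pos := fun ⟨a, b⟩ => by
    obtain ⟨x, hx, hxa⟩ := X.pos a
    obtain ⟨y, hy, hyb⟩ := Y.pos b
    exact ⟨pureTensor x y, subset_pcsOrth_pcsOrth _ ⟨x, hx, y, hy, rfl⟩, mul_pos hxa hyb⟩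
  bdd := fun ⟨a, b⟩ => by
    classical
    obtain ⟨M, hM⟩ := X.bdd a
    obtain ⟨N, hN⟩ := Y.bdd b
    have hpos : 0 < (M + 1) * (N + 1) := by positivity
    refine ⟨(M + 1) * (N + 1), ?_⟩
    rintro _ ⟨z, hz, rfl⟩
    have := hz (Pi.single (a, b) ((M + 1) * (N + 1))⁻¹) (by
      rintro _ ⟨x, hx, y, hy, rfl⟩
      rw [pcsPairing_single, ← ENNReal.coe_mul, ENNReal.coe_le_one_iff, mul_comm,
        inv_mul_le_iff₀ hpos, mul_one]
      exact mul_le_mul' ((hM ⟨x, hx, rfl⟩).trans le_self_add)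
        ((hN ⟨y, hy, rfl⟩).trans le_self_add))
    rw [pcsPairing_comm, pcsPairing_single, ← ENNReal.coe_mul, ENNReal.coe_le_one_iff, mul_comm,
      inv_mul_le_iff₀ hpos, mul_one] at this
    exact this

lemma pcsPairing_pureTensor {I J : Type u} (x : I → ℝ≥0) (y : J → ℝ≥0) (z : I × J → ℝ≥0) :
    pcsPairing (pureTensor x y) z =
      ∑' a, (x a : ℝ≥0∞) * ∑' b, (y b : ℝ≥0∞) * (z (a, b) : ℝ≥0∞) := by
  unfold pcsPairing
  have := ENNReal.tsum_prod (f := fun a b => ((pureTensor x y (a, b) : ℝ≥0) : ℝ≥0∞) * z (a, b))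
  rw [this]
  simp only [pureTensor, ENNReal.coe_mul, mul_assoc, ENNReal.tsum_mul_left]

lemma pureTensor_mem {x : X.web → ℝ≥0} (hx : x ∈ X.coh) {y : Y.web → ℝ≥0} (hy : y ∈ Y.coh) :
    pureTensor x y ∈ (tensor X Y).coh :=
  subset_pcsOrth_pcsOrth _ ⟨x, hx, y, hy, rfl⟩

lemma reindex_mem {I J : Type u} (e : I ≃ J) {U : Set (I → ℝ≥0)} {V : Set (J → ℝ≥0)}
    (h : ∀ w ∈ pcsOrth V, (fun a => w (e a)) ∈ pcsOrth U) {t : I → ℝ≥0}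
    (ht : t ∈ pcsOrth (pcsOrth U)) : (fun b => t (e.symm b)) ∈ pcsOrth (pcsOrth V) := by
  intro w hw
  refine le_of_eq_of_le ?_ (ht _ (h w hw))
  unfold pcsPairing
  rw [← e.tsum_eq]
  simp

lemma assoc_mem (X Y Z : PCS.{u}) {t : (X.web × Y.web) × Z.web → ℝ≥0}
    (ht : t ∈ pcsOrth (pcsOrth (pureTensors (pcsOrth (pcsOrth (pureTensors X.coh Y.coh))) Z.coh))) :
    (fun p => t ((Equiv.prodAssoc X.web Y.web Z.web).symm p)) ∈
      pcsOrth (pcsOrth (pureTensors X.coh (pcsOrth (pcsOrth (pureTensors Y.coh Z.coh))))) := by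
  refine reindex_mem _ (fun w hw => ?_) ht
  rintro _ ⟨s, hs, z, hz, rfl⟩
  have key : ∀ x ∈ X.coh, ∀ y ∈ Y.coh, ∑' a, (x a : ℝ≥0∞) * ∑' b, (y b : ℝ≥0∞) *
      ∑' c, (z c : ℝ≥0∞) * (w (a, b, c) : ℝ≥0∞) ≤ 1 := fun x hx y hy => by
    have := hw _ ⟨x, hx, _, pureTensor_mem hy hz, rfl⟩
    rw [pcsPairing_pureTensor] at this
    convert this using 4 with a
    exact (pcsPairing_pureTensor y z fun p => w (a, p)).symm
  have hfin : ∀ a b, ∑' c, (z c : ℝ≥0∞) * (w (a, b, c) : ℝ≥0∞) ≠ ⊤ := fun a b htop => by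
    obtain ⟨x, hx, hxa⟩ := X.pos a
    obtain ⟨y, hy, hyb⟩ := Y.pos b
    have h1 := ((ENNReal.le_tsum a).trans (key x hx y hy))
    have h2 := (mul_le_mul_right (ENNReal.le_tsum b) (x a : ℝ≥0∞)).trans h1
    rw [htop, ENNReal.mul_top (by simpa using hyb.ne'),
      ENNReal.mul_top (by simpa using hxa.ne')] at h2
    simp at h2
  have h3 := hs (fun p => (∑' c, (z c : ℝ≥0∞) * (w (p.1, p.2, c) : ℝ≥0∞)).toNNReal) (by
    rintro _ ⟨x, hx, y, hy, rfl⟩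
    rw [pcsPairing_pureTensor]
    simp only [ENNReal.coe_toNNReal (hfin _ _)]
    exact key x hx y hy)
  rw [pcsPairing_comm] at h3
  rw [pcsPairing_pureTensor]
  unfold pcsPairing at h3
  simp only [ENNReal.coe_toNNReal (hfin _ _)] at h3
  exact h3

/-- The PCS associator `(X ⊗ Y) ⊗ Z ⟶ X ⊗ (Y ⊗ Z)`: the permutation matrix of
`((a, b), c) ↦ (a, (b, c))`. -/
noncomputable def assocHom (X Y Z : PCS.{u}) :
    Hom (tensor (tensor X Y) Z) (tensor X (tensor Y Z)) :=
  Hom.ofEquiv (Equiv.prodAssoc X.web Y.web Z.web) fun _ => assoc_mem X Y Z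

lemma leftUnitor_mem (X : PCS.{u}) {t : PUnit.{u + 1} × X.web → ℝ≥0}
    (ht : t ∈ pcsOrth (pcsOrth (pureTensors {r | ∀ a, r a ≤ 1} X.coh))) :
    (fun p => t ((Equiv.punitProd X.web).symm p)) ∈ X.coh := by
  rw [← X.biorth]
  refine reindex_mem _ (fun w hw => ?_) ht
  rintro _ ⟨r, hr, x, hx, rfl⟩
  rw [pcsPairing_pureTensor, tsum_eq_single PUnit.unit fun b hb => absurd rfl hb]
  exact mul_le_one' (ENNReal.coe_le_one_iff.2 (hr _)) (hw x hx)

/-- The left unitor `1 ⊗ X ⟶ X`: the permutation matrix of `((), a) ↦ a`. -/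
noncomputable def leftUnitorHom (X : PCS.{u}) : Hom (tensor one X) X :=
  Hom.ofEquiv (Equiv.punitProd X.web) fun _ => leftUnitor_mem X

lemma symm_mem {I J : Type u} {U : Set (I → ℝ≥0)} {V : Set (J → ℝ≥0)} {t : I × J → ℝ≥0}
    (ht : t ∈ pcsOrth (pcsOrth (pureTensors U V))) :
    (fun p => t ((Equiv.prodComm I J).symm p)) ∈ pcsOrth (pcsOrth (pureTensors V U)) := by
  refine reindex_mem _ (fun w hw => ?_) ht
  rintro _ ⟨x, hx, y, hy, rfl⟩
  refine le_of_eq_of_le ?_ (hw _ ⟨y, hy, x, hx, rfl⟩)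
  unfold pcsPairing
  rw [← (Equiv.prodComm I J).tsum_eq]
  simp [pureTensor, mul_comm]

/-- The right unitor `X ⊗ 1 ⟶ X`: the permutation matrix of `(a, ()) ↦ a`. -/
noncomputable def rightUnitorHom (X : PCS.{u}) : Hom (tensor X one) X :=
  Hom.ofEquiv (Equiv.prodPUnit X.web) fun _ ht => leftUnitor_mem X (symm_mem ht)

/-- The symmetry `X ⊗ Y ⟶ Y ⊗ X`: the permutation matrix of `(a, b) ↦ (b, a)`. -/
noncomputable def symmHom (X Y : PCS.{u}) : Hom (tensor X Y) (tensor Y X) :=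
  Hom.ofEquiv (Equiv.prodComm X.web Y.web) fun _ => symm_mem

/-- The isomorphism `r ↦ (r)` from the cone `ℝ≥0` to `Cl 1`. -/
noncomputable def unitToCl : SCCLin.unit.{u} ⟶ Cl one.{u} :=
  SCCLin.Hom.mk (P := SCCLin.unit.{u}) (Q := Cl one.{u})
    { toFun := fun r : ULift.{u} ℝ≥0 => (⟨fun _ => r.down, (r.down + 1)⁻¹, by positivity,
        fun _ => by
          change (r.down + 1)⁻¹ * r.down ≤ 1
          rw [inv_mul_le_iff₀ (by positivity), mul_one]
          exact le_self_add⟩ : one.{u}.coneSubmodule)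
      map_add' := fun _ _ => rfl
      map_smul' := fun _ _ => rfl
      cont := fun s r hs h1 hr => isSeqLub_of_isLUB fun a => by
        refine ⟨?_, fun c hc => ?_⟩
        · rintro _ ⟨n, rfl⟩
          exact SCCLin.coneLE_ulift.1 (hr.1 n)
        · exact SCCLin.coneLE_ulift.1 (hr.2 ⟨c⟩ fun n => SCCLin.coneLE_ulift.2 (hc ⟨n, rfl⟩)) }
    (fun r hr => nrm_le_one_iff.2 fun _ => hr)

lemma pureTensor_mem_cone (x : X.coneSubmodule) (y : Y.coneSubmodule) :
    pureTensor x.1 y.1 ∈ (tensor X Y).coneSubmodule := by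
  obtain ⟨r, hr, hx⟩ := x.2
  obtain ⟨s, hs, hy⟩ := y.2
  refine ⟨r * s, mul_pos hr hs, ?_⟩
  have h : (r * s) • pureTensor x.1 y.1 = pureTensor (r • x.1) (s • y.1) :=
    funext fun p => mul_mul_mul_comm _ _ _ _
  have h2 : (r * s) • pureTensor x.1 y.1 ∈ pcsOrth (pcsOrth (pureTensors X.coh Y.coh)) :=
    h ▸ pureTensor_mem hx hy
  exact h2

/-- The bilinear map `(x, y) ↦ x ⊗ y` from `Cl X × Cl Y` to `Cl (X ⊗ Y)`. -/
noncomputable def tensorBilin (X Y : PCS.{u}) :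
    SCCLin.Bilin (Cl X) (Cl Y) (Cl (tensor X Y)) where
  toFun (x : X.coneSubmodule) (y : Y.coneSubmodule) :=
    (⟨pureTensor x.1 y.1, pureTensor_mem_cone x y⟩ : (tensor X Y).coneSubmodule)
  add_left _ _ _ := Subtype.ext (funext fun _ => add_mul _ _ _)
  smul_left _ _ _ := Subtype.ext (funext fun _ => mul_assoc _ _ _)
  add_right _ _ _ := Subtype.ext (funext fun _ => mul_add _ _ _)
  smul_right _ _ _ := Subtype.ext (funext fun _ => mul_left_comm _ _ _)
  cont_left y s x hs h1 hx := isSeqLub_of_isLUB fun p => by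
    have := (isLUB_apply hs h1 hx p.1).mul_right (a := y.1 p.2) zero_le
    rwa [← Set.range_comp] at this
  cont_right x s y hs h1 hy := isSeqLub_of_isLUB fun p => by
    have := (isLUB_apply hs h1 hy p.2).mul_left (a := x.1 p.1) zero_le
    rwa [← Set.range_comp] at this
  nrm_le_one x y hx hy :=
    nrm_le_one_iff.2 (pureTensor_mem (nrm_le_one_iff.1 hx) (nrm_le_one_iff.1 hy))

end PCS

/-! ### The tensor product of cones -/

open SCCLin in
/-- A tensor product of cones: a functor `⊗ : SCCLin × SCCLin ⥤ SCCLin` together with a bijection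
`SCCLin(P ⊗ Q, R) ≃ SCCLin(P, Q ⊸ R)`, natural in `P`, `Q` and `R`. -/
structure ConeTensor : Type (u + 1) where
  /-- the bifunctor -/
  functor : SCCLin.{u} × SCCLin.{u} ⥤ SCCLin.{u}
  /-- the bijection of the adjunction -/
  curry : ∀ P Q R : SCCLin.{u}, (functor.obj (P, Q) ⟶ R) ≃ (P ⟶ linHom Q R)
  curry_natural : ∀ {P P' Q Q' R R' : SCCLin.{u}} (f : P' ⟶ P) (g : Q' ⟶ Q) (h : R ⟶ R')
    (k : functor.obj (P, Q) ⟶ R),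
    curry P' Q' R' (functor.map (Prod.mkHom f g) ≫ k ≫ h) = f ≫ curry P Q R k ≫ linHomMap g h

namespace ConeTensor

open SCCLin

variable (T : ConeTensor.{u})

/-- The tensor product on objects. -/
abbrev obj (P Q : SCCLin.{u}) : SCCLin.{u} := T.functor.obj (P, Q)

/-- The tensor product on morphisms. -/
abbrev map {P P' Q Q' : SCCLin.{u}} (f : P ⟶ P') (g : Q ⟶ Q') : T.obj P Q ⟶ T.obj P' Q' :=
  T.functor.map (Prod.mkHom f g)

/-- The pure tensor `x ⊗ y`: the image of `(x, y)` under the universal bilinear map. -/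
noncomputable def tmul {P Q : SCCLin.{u}} (x : P) (y : Q) : T.obj P Q :=
  (T.curry P Q (T.obj P Q) (𝟙 _) x : linHom Q (T.obj P Q)) y

/-- The morphism `P ⊗ Q ⟶ R` induced by a bilinear map `P × Q → R`. -/
noncomputable def lift {P Q R : SCCLin.{u}} (b : Bilin P Q R) : T.obj P Q ⟶ R :=
  (T.curry P Q R).symm b.transpose

/-- The evaluation `(P ⊸ Q) ⊗ P ⟶ Q`, induced by the bilinear map `(f, x) ↦ f x`. -/
noncomputable def ev (P Q : SCCLin.{u}) : T.obj (linHom P Q) P ⟶ Q := T.lift (evalBilin P Q)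

/-- The comparison `Cl X ⊗ Cl Y ⟶ Cl (X ⊗ Y)`, induced by the bilinear map `(x, y) ↦ x ⊗ y`. -/
noncomputable def clComparison (X Y : PCS.{u}) :
    T.obj (PCS.Cl X) (PCS.Cl Y) ⟶ PCS.Cl (PCS.tensor X Y) :=
  T.lift (PCS.tensorBilin X Y)

/-- Natural isomorphisms of the types of the associator, the unitors and the symmetry. -/
structure Coherence where
  /-- the associator -/
  assoc : ∀ P Q R : SCCLin.{u}, T.obj (T.obj P Q) R ≅ T.obj P (T.obj Q R)
  assoc_natural : ∀ {P P' Q Q' R R' : SCCLin.{u}} (f : P ⟶ P') (g : Q ⟶ Q') (h : R ⟶ R'),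
    T.map (T.map f g) h ≫ (assoc P' Q' R').hom = (assoc P Q R).hom ≫ T.map f (T.map g h)
  /-- the left unitor -/
  leftUnitor : ∀ P : SCCLin.{u}, T.obj unit P ≅ P
  leftUnitor_natural : ∀ {P P' : SCCLin.{u}} (f : P ⟶ P'),
    T.map (𝟙 unit) f ≫ (leftUnitor P').hom = (leftUnitor P).hom ≫ f
  /-- the right unitor -/
  rightUnitor : ∀ P : SCCLin.{u}, T.obj P unit ≅ P
  rightUnitor_natural : ∀ {P P' : SCCLin.{u}} (f : P ⟶ P'),
    T.map f (𝟙 unit) ≫ (rightUnitor P').hom = (rightUnitor P).hom ≫ f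
  /-- the symmetry -/
  symm : ∀ P Q : SCCLin.{u}, T.obj P Q ≅ T.obj Q P
  symm_natural : ∀ {P P' Q Q' : SCCLin.{u}} (f : P ⟶ P') (g : Q ⟶ Q'),
    T.map f g ≫ (symm P' Q').hom = (symm P Q).hom ≫ T.map g f

namespace Coherence

variable {T} (c : T.Coherence)

/-- At the probabilistic coherence spaces satisfying `K`, the components of the four natural
isomorphisms are those of the symmetric monoidal category of probabilistic coherence spaces,
transported along the comparison morphisms `Cl X ⊗ Cl Y ⟶ Cl (X ⊗ Y)` and `ℝ≥0 ⟶ Cl 1`. -/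
structure ExtendsPCS (K : PCS.{u} → Prop) : Prop where
  assoc : ∀ X Y Z : PCS.{u}, K X → K Y → K Z →
    (c.assoc (PCS.Cl X) (PCS.Cl Y) (PCS.Cl Z)).hom ≫
        T.map (𝟙 _) (T.clComparison Y Z) ≫ T.clComparison X (PCS.tensor Y Z) =
      T.map (T.clComparison X Y) (𝟙 _) ≫ T.clComparison (PCS.tensor X Y) Z ≫
        (PCS.assocHom X Y Z).toCl
  leftUnitor : ∀ X : PCS.{u}, K X →
    (c.leftUnitor (PCS.Cl X)).hom =
      T.map PCS.unitToCl (𝟙 _) ≫ T.clComparison PCS.one X ≫ (PCS.leftUnitorHom X).toCl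
  rightUnitor : ∀ X : PCS.{u}, K X →
    (c.rightUnitor (PCS.Cl X)).hom =
      T.map (𝟙 _) PCS.unitToCl ≫ T.clComparison X PCS.one ≫ (PCS.rightUnitorHom X).toCl
  symm : ∀ X Y : PCS.{u}, K X → K Y →
    (c.symm (PCS.Cl X) (PCS.Cl Y)).hom ≫ T.clComparison Y X =
      T.clComparison X Y ≫ (PCS.symmHom X Y).toCl

/-- The four natural isomorphisms on pure tensors. -/
structure OnPureTensors : Prop where
  assoc : ∀ (P Q R : SCCLin.{u}) (x : P) (y : Q) (z : R),
    (c.assoc P Q R).hom (T.tmul (T.tmul x y) z) = T.tmul x (T.tmul y z)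
  leftUnitor : ∀ (P : SCCLin.{u}) (r : ℝ≥0) (x : P),
    (c.leftUnitor P).hom (T.tmul (scalar r) x) = r • x
  rightUnitor : ∀ (P : SCCLin.{u}) (x : P) (r : ℝ≥0),
    (c.rightUnitor P).hom (T.tmul x (scalar r)) = r • x
  symm : ∀ (P Q : SCCLin.{u}) (x : P) (y : Q),
    (c.symm P Q).hom (T.tmul x y) = T.tmul y x

/-- The coherence axioms of symmetric monoidal categories. -/
structure IsSymmetricMonoidal : Prop where
  pentagon : ∀ P Q R S : SCCLin.{u},
    T.map (c.assoc P Q R).hom (𝟙 S) ≫ (c.assoc P (T.obj Q R) S).hom ≫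
        T.map (𝟙 P) (c.assoc Q R S).hom =
      (c.assoc (T.obj P Q) R S).hom ≫ (c.assoc P Q (T.obj R S)).hom
  triangle : ∀ P Q : SCCLin.{u},
    (c.assoc P unit Q).hom ≫ T.map (𝟙 P) (c.leftUnitor Q).hom =
      T.map (c.rightUnitor P).hom (𝟙 Q)
  hexagon : ∀ P Q R : SCCLin.{u},
    (c.assoc P Q R).hom ≫ (c.symm P (T.obj Q R)).hom ≫ (c.assoc Q R P).hom =
      T.map (c.symm P Q).hom (𝟙 R) ≫ (c.assoc Q P R).hom ≫ T.map (𝟙 Q) (c.symm P R).hom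
  symmetry : ∀ P Q : SCCLin.{u}, (c.symm P Q).hom ≫ (c.symm Q P).hom = 𝟙 (T.obj P Q)

variable {c}

/-- The monoidal category with tensor product `T` and the given associator and unitors. -/
noncomputable abbrev monoidalCategory (h : c.IsSymmetricMonoidal) :
    MonoidalCategory SCCLin.{u} where
  tensorObj P Q := T.obj P Q
  whiskerLeft P _ _ f := T.map (𝟙 P) f
  whiskerRight f P := T.map f (𝟙 P)
  tensorHom f g := T.map f g
  tensorUnit := unit
  associator := c.assoc
  leftUnitor := c.leftUnitor
  rightUnitor := c.rightUnitor
  tensorHom_def f g := by simp [← Functor.map_comp]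
  id_tensorHom_id P Q := T.functor.map_id (P, Q)
  tensorHom_comp_tensorHom f₁ f₂ g₁ g₂ := (T.functor.map_comp _ _).symm
  whiskerLeft_id P Q := T.functor.map_id (P, Q)
  id_whiskerRight P Q := T.functor.map_id (P, Q)
  associator_naturality := c.assoc_natural
  leftUnitor_naturality := c.leftUnitor_natural
  rightUnitor_naturality := c.rightUnitor_natural
  pentagon := h.pentagon
  triangle := h.triangle

/-- The symmetric monoidal category with tensor product `T` and the given natural
isomorphisms. -/
noncomputable abbrev symmetricCategory (h : c.IsSymmetricMonoidal) :
    letI := monoidalCategory h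
    SymmetricCategory SCCLin.{u} :=
  letI := monoidalCategory h
  { braiding := c.symm
    braiding_naturality_right := fun P _ _ f => c.symm_natural (𝟙 P) f
    braiding_naturality_left := fun f P => c.symm_natural f (𝟙 P)
    hexagon_forward := h.hexagon
    hexagon_reverse := fun P Q R => by
      have hβ : ∀ A B, (c.symm A B).hom = (c.symm B A).inv := fun A B =>
        (Iso.comp_hom_eq_id (c.symm B A)).1 (h.symmetry A B)
      have hh : c.assoc R P Q ≪≫ c.symm R (T.obj P Q) ≪≫ c.assoc P Q R =
          T.functor.mapIso ((c.symm R P).prod (Iso.refl Q)) ≪≫ c.assoc P R Q ≪≫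
            T.functor.mapIso ((Iso.refl P).prod (c.symm R Q)) := Iso.ext (h.hexagon R P Q)
      have h2 := congrArg Iso.inv hh
      simp only [Iso.trans_inv, Category.assoc, Functor.mapIso_inv] at h2
      change (c.assoc P Q R).inv ≫ (c.symm (T.obj P Q) R).hom ≫ (c.assoc R P Q).inv =
        T.map (𝟙 P) (c.symm Q R).hom ≫ (c.assoc P R Q).inv ≫ T.map (c.symm P R).hom (𝟙 Q)
      rw [hβ (T.obj P Q) R, hβ Q R, hβ P R]
      exact h2
    symmetry := h.symmetry }

end Coherence

end ConeTensor

/-!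
The tensor product `P ⊗ Q` should be an initial object of the category of all bilinear maps
`k : P × Q → R`, hence the limit of all the codomains `R`, if that limit exists. It does, although
the category is large: an element `(r_k)` of the limit is determined by its components at the
bilinear forms `P × Q → ℝ≥0`, because cones are separated (`SCCLin.eq_of_forall_hom_unit`). So
`SCCLin.tensorModule` consists of the families of scalars, indexed by the bilinear forms of norm at
most `1`, that represent an element of every `R`, with bounded norms. Its order, its norm and its
least upper bounds are computed componentwise, since differences and least upper bounds in a cone
are unique and therefore compatible with morphisms. As in Freyd's construction of initial objects,
the component at the universal bilinear map is the identity (`SCCLin.tensorDesc_tensorUniv`), and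
this gives the uniqueness part of the universal property.

For an arbitrary tensor product, the bijection with `SCCLin(P, Q ⊸ R)` says that morphisms are
determined by their values on pure tensors (`ConeTensor.hom_ext`) and, after currying, on iterated
pure tensors. The symmetry and the left unitor are induced by bilinear maps, the associator by
currying twice; its inverse is obtained by conjugation with symmetries. All axioms and all
compatibilities with probabilistic coherence spaces are then checked on pure tensors.

An element of `Cl X` is the least upper bound of its finite truncations, so a morphism from `Cl X`
is determined by the basis vectors (`PCS.contLin_ext`). If `X` is a cube, any family whose finite
sums have norm at most `1` extends to a morphism (`PCS.IsCube.exists_hom`). As a tensor product of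
cubes is a cube, this yields the inverse of `Cl X ⊗ Cl Y ⟶ Cl (X ⊗ Y)`. The natural isomorphisms
are unique, since every element of a cone is in the image of a morphism from `Cl 1`
(`PCS.exists_hom_one_apply_eq`), so that by naturality a transformation is determined by its
component at `Cl 1`, where `1` is a cube.
-/

/-! ### Existence of the tensor product -/

namespace SCCLin

lemma linHom_ext {P Q : SCCLin.{u}} {f g : linHom P Q} (h : ∀ x, f x = g x) : f = g :=
  ContLin.ext h

lemma hom_nrm_le {P Q : SCCLin.{u}} (f : P ⟶ Q) (x : P) : nrm (f x) ≤ nrm x :=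
  Hom.nrm_le f x

lemma linHom_nrm_apply_le {P Q : SCCLin.{u}} (f : linHom P Q) (x : P) :
    nrm (f x) ≤ nrm f * nrm x :=
  ContLin.nrm_apply_le (P := P) (Q := Q) f x

/-- Rescaling a linear and continuous functional to norm at most `1` shows that the morphisms to
the unit object already separate points. -/
lemma eq_of_forall_hom_unit {R : SCCLin.{u}} {x y : R} (h : ∀ f : R ⟶ unit.{u}, f x = f y) :
    x = y := by
  refine SeparatedCone.sep x y fun f => ?_
  have hc : (f.opNrm + 1) ≠ 0 := by positivity
  let g : R ⟶ unit.{u} := Hom.mk (Q := unit.{u})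
    { toFun := fun z => (ULift.up ((f.opNrm + 1)⁻¹ * f z) : ULift.{u} ℝ≥0)
      map_add' := fun a b => ULift.ext _ _ (by
        change (f.opNrm + 1)⁻¹ * f (a + b) = (f.opNrm + 1)⁻¹ * f a + (f.opNrm + 1)⁻¹ * f b
        rw [map_add, mul_add])
      map_smul' := fun r a => ULift.ext _ _ (by
        change (f.opNrm + 1)⁻¹ * f (r • a) = r * ((f.opNrm + 1)⁻¹ * f a)
        rw [map_smul, smul_eq_mul, mul_left_comm])
      cont := fun s z hs h1 hz => by
        have := (f.cont s z hs h1 hz).smul (inv_ne_zero hc)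
        refine ⟨fun n => coneLE_ulift.2 (coneLE_nnreal.1 (this.1 n)), fun w hw => ?_⟩
        exact coneLE_ulift.2 (coneLE_nnreal.1 (this.2 w.down fun n =>
          coneLE_nnreal.2 (coneLE_ulift.1 (hw n)))) }
    (fun z hz => by
      change (f.opNrm + 1)⁻¹ * f z ≤ 1
      rw [inv_mul_le_iff₀ (by positivity), mul_one]
      exact (f.nrm_apply_le_opNrm hz).trans le_self_add)
  have h1 : (f.opNrm + 1)⁻¹ * f x = (f.opNrm + 1)⁻¹ * f y := congrArg ULift.down (h g)
  exact mul_left_cancel₀ (inv_ne_zero hc) h1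

/-- The family `e` of scalars, indexed by the bilinear forms of norm at most `1` on `P × Q`,
represents `r` along the bilinear map `k`: the functional `f` takes the value `e (f ∘ k)` at `r`. -/
def Represents {P Q R : SCCLin.{u}} (e : (P ⟶ linHom Q unit.{u}) → unit.{u})
    (k : P ⟶ linHom Q R) (r : R) : Prop :=
  ∀ f : R ⟶ unit.{u}, f r = e (k ≫ linHomMap (𝟙 Q) f)

namespace Represents

variable {P Q R R' : SCCLin.{u}} {e e' : (P ⟶ linHom Q unit.{u}) → unit.{u}}
  {k : P ⟶ linHom Q R} {r r' : R}

lemma unique (h : Represents e k r) (h' : Represents e k r') : r = r' :=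
  eq_of_forall_hom_unit fun f => (h f).trans (h' f).symm

lemma add (h : Represents e k r) (h' : Represents e' k r') : Represents (e + e') k (r + r') :=
  fun f => by rw [map_add, h f, h' f]; rfl

lemma smul (t : ℝ≥0) (h : Represents e k r) : Represents (t • e) k (t • r) :=
  fun f => by rw [map_smul, h f]; rfl

lemma zero : Represents 0 k (0 : R) := fun f => map_zero (Hom.toContLin f)

lemma comp (h : Represents e k r) (g : R ⟶ R') : Represents e (k ≫ linHomMap (𝟙 Q) g) (g r) :=
  fun f => h (g ≫ f)

lemma eq_of_unit {k : P ⟶ linHom Q unit.{u}} {r : unit.{u}} (h : Represents e k r) : e k = r :=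
  (h (𝟙 _)).symm

end Represents

/-- The underlying module of the tensor product of `P` and `Q`: the families of scalars which
represent an element along every bilinear map out of `P × Q`, with a common bound on the norms.
Such a family amounts to an element of the limit of all the codomains `R`; the quantifier over
the proper class of all `R` is harmless, since it is inside a proposition. -/
def tensorModule (P Q : SCCLin.{u}) :
    Submodule ℝ≥0 ((P ⟶ linHom Q unit.{u}) → unit.{u}) where
  carrier := {e | ∃ c : ℝ≥0, ∀ (R : SCCLin.{u}) (k : P ⟶ linHom Q R),
    ∃ r : R, nrm r ≤ c ∧ Represents e k r}
  add_mem' := by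
    rintro e e' ⟨c, hc⟩ ⟨c', hc'⟩
    refine ⟨c + c', fun R k => ?_⟩
    obtain ⟨r, hr, h⟩ := hc R k
    obtain ⟨r', hr', h'⟩ := hc' R k
    exact ⟨r + r', (PositiveCone.nrm_add_le _ _).trans (add_le_add hr hr'), h.add h'⟩
  zero_mem' := ⟨0, fun R k => ⟨0, PositiveCone.nrm_zero.le, Represents.zero⟩⟩
  smul_mem' := by
    rintro t e ⟨c, hc⟩
    refine ⟨t * c, fun R k => ?_⟩
    obtain ⟨r, hr, h⟩ := hc R k
    exact ⟨t • r, by rw [PositiveCone.nrm_smul]; gcongr, h.smul t⟩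

namespace tensorModule

variable {P Q R R' : SCCLin.{u}}

/-- The element of `R` represented by a tensor along a bilinear map. -/
noncomputable def component (k : P ⟶ linHom Q R) (e : tensorModule P Q) : R :=
  (e.2.choose_spec R k).choose

lemma represents (k : P ⟶ linHom Q R) (e : tensorModule P Q) :
    Represents e.1 k (component k e) :=
  (e.2.choose_spec R k).choose_spec.2

lemma exists_nrm_component_le (e : tensorModule P Q) :
    ∃ c, ∀ (R : SCCLin.{u}) (k : P ⟶ linHom Q R), nrm (component k e) ≤ c :=
  ⟨e.2.choose, fun R k => (e.2.choose_spec R k).choose_spec.1⟩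

lemma component_add (k : P ⟶ linHom Q R) (e e' : tensorModule P Q) :
    component k (e + e') = component k e + component k e' :=
  (represents k (e + e')).unique ((represents k e).add (represents k e'))

lemma component_smul (k : P ⟶ linHom Q R) (t : ℝ≥0) (e : tensorModule P Q) :
    component k (t • e) = t • component k e :=
  (represents k (t • e)).unique ((represents k e).smul t)

lemma component_comp (k : P ⟶ linHom Q R) (g : R ⟶ R') (e : tensorModule P Q) :
    component (k ≫ linHomMap (𝟙 Q) g) e = g (component k e) :=
  (represents _ e).unique ((represents k e).comp g)

lemma ext_component {e e' : tensorModule P Q}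
    (h : ∀ (R : SCCLin.{u}) (k : P ⟶ linHom Q R), component k e = component k e') : e = e' :=
  Subtype.ext (funext fun k => by
    rw [(represents k e).eq_of_unit, (represents k e').eq_of_unit, h])

/-- A bounded family of elements which is compatible with the morphisms to the unit object
comes from a tensor. -/
lemma exists_component_eq (r : ∀ (R : SCCLin.{u}), (P ⟶ linHom Q R) → R) (c : ℝ≥0)
    (hc : ∀ R k, nrm (r R k) ≤ c)
    (hr : ∀ (R : SCCLin.{u}) (k : P ⟶ linHom Q R) (f : R ⟶ unit.{u}),
      f (r R k) = r _ (k ≫ linHomMap (𝟙 Q) f)) :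
    ∃ e : tensorModule P Q, ∀ R (k : P ⟶ linHom Q R), component k e = r R k :=
  let e : tensorModule P Q := ⟨fun k => r _ k, c, fun R k => ⟨r R k, hc R k, hr R k⟩⟩
  ⟨e, fun R k => (represents k e).unique (hr R k)⟩

/-- The norm of a tensor is the supremum of the norms of its components. -/
noncomputable def norm (e : tensorModule P Q) : ℝ≥0 :=
  sInf {c | ∀ (R : SCCLin.{u}) (k : P ⟶ linHom Q R), nrm (component k e) ≤ c}

lemma norm_le_iff {e : tensorModule P Q} {c : ℝ≥0} :
    norm e ≤ c ↔ ∀ (R : SCCLin.{u}) (k : P ⟶ linHom Q R), nrm (component k e) ≤ c :=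
  ⟨fun h R k => (le_csInf (exists_nrm_component_le e) fun _ hb => hb R k).trans h,
    fun h => csInf_le (OrderBot.bddBelow _) h⟩

lemma nrm_component_le (k : P ⟶ linHom Q R) (e : tensorModule P Q) :
    nrm (component k e) ≤ norm e :=
  norm_le_iff.1 le_rfl R k

noncomputable instance : PositiveCone (tensorModule P Q) where
  nrm := norm
  nrm_smul t e := by
    have hle : ∀ (t : ℝ≥0) (e : tensorModule P Q), norm (t • e) ≤ t * norm e := fun t e =>
      norm_le_iff.2 fun R k => by
        rw [component_smul, PositiveCone.nrm_smul]
        exact mul_le_mul_right (nrm_component_le k e) t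
    refine le_antisymm (hle t e) ?_
    rcases eq_or_ne t 0 with rfl | ht
    · rw [zero_mul]; exact zero_le
    · have := hle t⁻¹ (t • e)
      rw [inv_smul_smul₀ ht] at this
      calc t * norm e ≤ t * (t⁻¹ * norm (t • e)) := mul_le_mul_right this t
        _ = norm (t • e) := by rw [mul_inv_cancel_left₀ ht]
  nrm_add_le e e' := norm_le_iff.2 fun R k => by
    rw [component_add]
    exact (PositiveCone.nrm_add_le _ _).trans
      (add_le_add (nrm_component_le k e) (nrm_component_le k e'))
  eq_zero_of_nrm_eq_zero e h := ext_component fun R k => by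
    rw [(represents k (0 : tensorModule P Q)).unique Represents.zero]
    exact PositiveCone.eq_zero_of_nrm_eq_zero _ (le_antisymm (norm_le_iff.1 h.le R k) zero_le)
  cancel e e' e'' h := ext_component fun R k => PositiveCone.cancel _ _ (component k e'') (by
    rw [← component_add, ← component_add, h])
  nrm_le_nrm_add e e' := norm_le_iff.2 fun R k =>
    (PositiveCone.nrm_le_nrm_add (component k e) (component k e')).trans (by
      rw [← component_add]
      exact nrm_component_le k (e + e'))

/-- The algebraic order of the tensor product is the componentwise order: componentwise
differences are compatible, because differences are unique in a cancellative cone. -/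
lemma coneLE_iff {e e' : tensorModule P Q} :
    ConeLE e e' ↔ ∀ (R : SCCLin.{u}) (k : P ⟶ linHom Q R),
      ConeLE (component k e) (component k e') := by
  constructor
  · rintro ⟨d, rfl⟩ R k
    exact ⟨component k d, (component_add k e d).symm⟩
  · intro h
    choose d hd using h
    obtain ⟨e'', he⟩ := exists_component_eq d (norm e')
      (fun R k => by
        have h1 : ConeLE (d R k) (component k e') :=
          ⟨component k e, by rw [add_comm]; exact hd R k⟩
        exact h1.nrm_le.trans (nrm_component_le k e'))
      (fun R k f => PositiveCone.cancel _ _ (f (component k e)) (by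
        rw [← map_add, add_comm, hd, ← component_comp, ← component_comp, add_comm, hd]))
    exact ⟨e'', ext_component fun R k => by rw [component_add, he, hd]⟩

lemma monoSeq_component {s : ℕ → tensorModule P Q} (hs : IsMonoSeq s) (k : P ⟶ linHom Q R) :
    IsMonoSeq fun n => component k (s n) :=
  fun m n h => coneLE_iff.1 (hs m n h) R k

lemma isSeqLub_of_component {s : ℕ → tensorModule P Q} {e : tensorModule P Q}
    (h : ∀ (R : SCCLin.{u}) (k : P ⟶ linHom Q R),
      IsSeqLub (fun n => component k (s n)) (component k e)) : IsSeqLub s e :=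
  ⟨fun n => coneLE_iff.2 fun R k => (h R k).1 n, fun y hy => coneLE_iff.2 fun R k =>
    (h R k).2 _ fun n => coneLE_iff.1 (hy n) R k⟩

lemma exists_componentwise_lub {s : ℕ → tensorModule P Q} (hs : IsMonoSeq s)
    (h1 : ∀ n, nrm (s n) ≤ 1) :
    ∃ e : tensorModule P Q, nrm e ≤ 1 ∧ ∀ (R : SCCLin.{u}) (k : P ⟶ linHom Q R),
      IsSeqLub (fun n => component k (s n)) (component k e) := by
  have hb : ∀ (R : SCCLin.{u}) (k : P ⟶ linHom Q R) n, nrm (component k (s n)) ≤ 1 :=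
    fun R k n => norm_le_iff.1 (h1 n) R k
  choose l hl1 hl using fun (R : SCCLin.{u}) (k : P ⟶ linHom Q R) =>
    CompleteCone.exists_lub _ (monoSeq_component hs k) (hb R k)
  obtain ⟨e, he⟩ := exists_component_eq l 1 hl1 (fun R k f => by
    have := (Hom.toContLin f).cont _ _ (monoSeq_component hs k) (hb R k) (hl R k)
    refine IsSeqLub.unique this ?_
    have h2 := hl _ (k ≫ linHomMap (𝟙 Q) f)
    simp only [component_comp] at h2
    exact h2)
  refine ⟨e, norm_le_iff.2 fun R k => ?_, fun R k => ?_⟩ <;> rw [he]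
  exacts [hl1 R k, hl R k]

instance : CompleteCone (tensorModule P Q) where
  exists_lub s hs h1 := by
    obtain ⟨e, he, h⟩ := exists_componentwise_lub hs h1
    exact ⟨e, he, isSeqLub_of_component h⟩

/-- Taking components is linear and continuous. -/
noncomputable def componentContLin (k : P ⟶ linHom Q R) : ContLin (tensorModule P Q) R where
  toFun := component k
  map_add' := component_add k
  map_smul' := component_smul k
  cont s e hs h1 he := by
    obtain ⟨e', -, h⟩ := exists_componentwise_lub hs h1
    rw [he.unique (isSeqLub_of_component h)]
    exact h R k

instance : SeparatedCone (tensorModule P Q) where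
  sep e e' h := ext_component fun R k => SeparatedCone.sep _ _ fun f =>
    h (f.comp (componentContLin k))

lemma exists_component_eq_apply (x : P) (y : Q) :
    ∃ e : tensorModule P Q, ∀ R (k : P ⟶ linHom Q R), component k e = (k x : linHom Q R) y :=
  exists_component_eq (fun R k => (k x : linHom Q R) y) (nrm x * nrm y)
    (fun R k => (linHom_nrm_apply_le _ _).trans (mul_le_mul_left (hom_nrm_le k x) _))
    (fun R k f => rfl)

/-- The pure tensor of `x` and `y`, given by its components `k x y`. -/
noncomputable def pure (x : P) (y : Q) : tensorModule P Q := (exists_component_eq_apply x y).choose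

lemma component_pure (k : P ⟶ linHom Q R) (x : P) (y : Q) :
    component k (pure x y) = (k x : linHom Q R) y :=
  (exists_component_eq_apply x y).choose_spec R k

lemma pure_add_left (x x' : P) (y : Q) : pure (x + x') y = pure x y + pure x' y :=
  ext_component fun R k => by
    rw [component_add, component_pure, component_pure, component_pure, map_add]; rfl

lemma pure_smul_left (r : ℝ≥0) (x : P) (y : Q) : pure (r • x) y = r • pure x y :=
  ext_component fun R k => by
    rw [component_smul, component_pure, component_pure, map_smul]; rfl

lemma pure_add_right (x : P) (y y' : Q) : pure x (y + y') = pure x y + pure x y' :=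
  ext_component fun R k => by
    rw [component_add, component_pure, component_pure, component_pure]
    exact map_add (F := ContLin Q R) _ _ _

lemma pure_smul_right (r : ℝ≥0) (x : P) (y : Q) : pure x (r • y) = r • pure x y :=
  ext_component fun R k => by
    rw [component_smul, component_pure, component_pure]
    exact map_smul (F := ContLin Q R) _ _ _

end tensorModule

/-- The tensor product of two separated complete positive cones. -/
noncomputable def tensorObj (P Q : SCCLin.{u}) : SCCLin.{u} := ⟨tensorModule P Q⟩

open tensorModule in
/-- The morphism out of the tensor product that corresponds to a bilinear map. -/
noncomputable def tensorDesc {P Q R : SCCLin.{u}} (k : P ⟶ linHom Q R) : tensorObj P Q ⟶ R :=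
  Hom.mk (P := tensorObj P Q) (componentContLin k)
    fun e he => (nrm_component_le k (e : tensorModule P Q)).trans he

open tensorModule in
/-- The universal bilinear map: the component of `(x, y)` along `k` is `k x y`. -/
noncomputable def tensorUniv (P Q : SCCLin.{u}) : P ⟶ linHom Q (tensorObj P Q) :=
  Bilin.transpose (R := tensorObj P Q)
    { toFun := pure
      add_left := pure_add_left
      smul_left := pure_smul_left
      add_right := pure_add_right
      smul_right := pure_smul_right
      cont_left := fun y s x hs h1 hx => isSeqLub_of_component fun R k => by
        simp only [component_pure]
        exact ContLin.isSeqLub_apply ((Hom.toContLin k).monoSeq hs)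
          (fun n => Hom.nrm_le_one k _ (h1 n)) ((Hom.toContLin k).cont s x hs h1 hx) y
      cont_right := fun x s y hs h1 hy => isSeqLub_of_component fun R k => by
        simp only [component_pure]
        exact ContLin.cont (k x : ContLin Q R) s y hs h1 hy
      nrm_le_one := fun x y hx hy => norm_le_iff.2 fun R k => by
        rw [component_pure]
        exact ((linHom_nrm_apply_le _ _).trans
          (mul_le_mul' ((hom_nrm_le k x).trans hx) hy)).trans (mul_one 1).le }

lemma tensorDesc_univ {P Q R : SCCLin.{u}} (k : P ⟶ linHom Q R) (x : P) (y : Q) :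
    tensorDesc k ((tensorUniv P Q x : linHom Q (tensorObj P Q)) y) = (k x : linHom Q R) y :=
  tensorModule.component_pure k x y

lemma univ_comp_desc {P Q R : SCCLin.{u}} (k : P ⟶ linHom Q R) :
    tensorUniv P Q ≫ linHomMap (𝟙 Q) (tensorDesc k) = k :=
  hom_ext fun x => linHom_ext fun y => tensorDesc_univ k x y

lemma tensorDesc_comp {P Q R R' : SCCLin.{u}} (k : P ⟶ linHom Q R) (g : R ⟶ R') :
    tensorDesc (k ≫ linHomMap (𝟙 Q) g) = tensorDesc k ≫ g :=
  hom_ext fun e => tensorModule.component_comp k g e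

/-- The component along the universal bilinear map is the identity: it does not change any other
component, by compatibility with `tensorDesc k`. -/
lemma tensorDesc_tensorUniv (P Q : SCCLin.{u}) : tensorDesc (tensorUniv P Q) = 𝟙 _ :=
  hom_ext fun e => tensorModule.ext_component fun R k => by
    have := congrArg (fun g : tensorObj P Q ⟶ R => g e)
      (tensorDesc_comp (tensorUniv P Q) (tensorDesc k))
    rw [univ_comp_desc] at this
    exact this.symm

lemma tensorDesc_univ_comp {P Q R : SCCLin.{u}} (g : tensorObj P Q ⟶ R) :
    tensorDesc (tensorUniv P Q ≫ linHomMap (𝟙 Q) g) = g := by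
  rw [tensorDesc_comp, tensorDesc_tensorUniv, Category.id_comp]

lemma tensorObj_hom_ext {P Q R : SCCLin.{u}} {g h : tensorObj P Q ⟶ R}
    (H : ∀ x y, g ((tensorUniv P Q x : linHom Q (tensorObj P Q)) y) =
      h ((tensorUniv P Q x : linHom Q (tensorObj P Q)) y)) : g = h := by
  rw [← tensorDesc_univ_comp g, ← tensorDesc_univ_comp h]
  congr 1
  exact hom_ext fun x => linHom_ext fun y => H x y

/-- The action of the tensor product on morphisms. -/
noncomputable def tensorMap {P P' Q Q' : SCCLin.{u}} (f : P ⟶ P') (g : Q ⟶ Q') :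
    tensorObj P Q ⟶ tensorObj P' Q' :=
  tensorDesc (f ≫ tensorUniv _ _ ≫ linHomMap g (𝟙 _))

lemma tensorMap_univ {P P' Q Q' : SCCLin.{u}} (f : P ⟶ P') (g : Q ⟶ Q') (x : P) (y : Q) :
    tensorMap f g ((tensorUniv P Q x : linHom Q (tensorObj P Q)) y) =
      (tensorUniv P' Q' (f x) : linHom Q' (tensorObj P' Q')) (g y) :=
  tensorDesc_univ _ x y

/-- A tensor product of cones. -/
noncomputable def coneTensor : ConeTensor.{u} where
  functor :=
    { obj := fun p => tensorObj p.1 p.2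
      map := fun f => tensorMap f.1 f.2
      map_id := fun p => tensorObj_hom_ext fun x y => tensorMap_univ _ _ x y
      map_comp := fun f g => tensorObj_hom_ext fun x y => (tensorMap_univ _ _ x y).trans
        ((congrArg (Hom.toContLin (tensorMap g.1 g.2)) (tensorMap_univ f.1 f.2 x y)).trans
          (tensorMap_univ _ _ _ _)).symm }
  curry P Q R :=
    { toFun := fun g => tensorUniv P Q ≫ linHomMap (𝟙 Q) g
      invFun := tensorDesc
      left_inv := tensorDesc_univ_comp
      right_inv := univ_comp_desc }
  curry_natural f g h k := hom_ext fun x => linHom_ext fun y =>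
    congrArg (fun z => h (k z)) (tensorMap_univ f g x y)

end SCCLin

/-! ### The universal property of an arbitrary tensor product -/

namespace ConeTensor

open SCCLin

variable (T : ConeTensor.{u})

section Universal

variable {T} {P P' Q Q' R S U : SCCLin.{u}}

lemma curry_apply (k : T.obj P Q ⟶ R) (x : P) (y : Q) :
    (T.curry P Q R k x : linHom Q R) y = k (T.tmul x y) := by
  have h := T.curry_natural (𝟙 P) (𝟙 Q) k (𝟙 (T.obj P Q))
  have h1 : T.functor.map (Prod.mkHom (𝟙 P) (𝟙 Q)) = 𝟙 _ := T.functor.map_id (P, Q)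
  rw [h1, Category.id_comp, Category.id_comp, Category.id_comp] at h
  rw [h]
  rfl

lemma curry_symm_tmul (k : P ⟶ linHom Q R) (x : P) (y : Q) :
    (T.curry P Q R).symm k (T.tmul x y) = (k x : linHom Q R) y := by
  rw [← curry_apply, Equiv.apply_symm_apply]

lemma lift_tmul (b : Bilin P Q R) (x : P) (y : Q) : T.lift b (T.tmul x y) = b x y :=
  curry_symm_tmul _ x y

lemma hom_ext {g h : T.obj P Q ⟶ R} (H : ∀ x y, g (T.tmul x y) = h (T.tmul x y)) : g = h :=
  (T.curry P Q R).injective <| SCCLin.hom_ext fun x => linHom_ext fun y => by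
    rw [curry_apply, curry_apply, H]

lemma map_tmul (f : P ⟶ P') (g : Q ⟶ Q') (x : P) (y : Q) :
    T.map f g (T.tmul x y) = T.tmul (f x) (g y) := by
  have h := T.curry_natural f g (𝟙 _) (𝟙 _)
  have h1 := congrArg (fun k : P ⟶ linHom Q (T.obj P' Q') => (k x : linHom Q (T.obj P' Q')) y) h
  simp only [Category.comp_id] at h1
  rw [curry_apply] at h1
  exact h1

/-- Morphisms out of `(P ⊗ Q) ⊗ R` are determined by the tensors `(x ⊗ y) ⊗ z`, by currying. -/
lemma hom_ext₃ {g h : T.obj (T.obj P Q) R ⟶ S}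
    (H : ∀ x y z, g (T.tmul (T.tmul x y) z) = h (T.tmul (T.tmul x y) z)) : g = h :=
  (T.curry _ _ _).injective <| hom_ext fun x y => linHom_ext fun z => by
    rw [curry_apply, curry_apply, H]

lemma hom_ext₄ {g h : T.obj (T.obj (T.obj P Q) R) S ⟶ U}
    (H : ∀ x y z w, g (T.tmul (T.tmul (T.tmul x y) z) w) = h (T.tmul (T.tmul (T.tmul x y) z) w)) :
    g = h :=
  (T.curry _ _ _).injective <| hom_ext₃ fun x y z => linHom_ext fun w => by
    rw [curry_apply, curry_apply, H]

variable (T P Q) in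
/-- The universal bilinear map `(x, y) ↦ x ⊗ y`. -/
noncomputable def tmulBilin : Bilin P Q (T.obj P Q) where
  toFun := T.tmul
  add_left x x' y := by
    simp only [tmul, map_add]; rfl
  smul_left r x y := by
    simp only [tmul, map_smul]; rfl
  add_right x := map_add (F := ContLin Q (T.obj P Q)) _
  smul_right r x y := map_smul (F := ContLin Q (T.obj P Q)) _ r y
  cont_left y s x hs h1 hx :=
    let k := T.curry P Q _ (𝟙 (T.obj P Q))
    ContLin.isSeqLub_apply ((Hom.toContLin k).monoSeq hs)
      (fun n => Hom.nrm_le_one k _ (h1 n)) ((Hom.toContLin k).cont s x hs h1 hx) y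
  cont_right x := ContLin.cont (T.curry P Q _ (𝟙 (T.obj P Q)) x : ContLin Q (T.obj P Q))
  nrm_le_one x y hx hy := (linHom_nrm_apply_le _ _).trans
    ((mul_le_mul' ((hom_nrm_le _ x).trans hx) hy).trans (mul_one 1).le)

end Universal

end ConeTensor

/-! ### The structural isomorphisms -/

namespace SCCLin

/-- The bilinear map with the arguments exchanged. -/
def Bilin.flip {P Q R : SCCLin.{u}} (b : Bilin P Q R) : Bilin Q P R where
  toFun y x := b x y
  add_left y y' x := b.add_right x y y'
  smul_left r y x := b.smul_right r x y
  add_right y x x' := b.add_left x x' y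
  smul_right r y x := b.smul_left r x y
  cont_left x := b.cont_right x
  cont_right y := b.cont_left y
  nrm_le_one y x hy hx := b.nrm_le_one x y hx hy

/-- Composition `(h, k) ↦ h ∘ k` as a bilinear map. -/
noncomputable def compBilin (P Q R : SCCLin.{u}) :
    Bilin (linHom Q R) (linHom P Q) (linHom P R) where
  toFun h k := (ContLin.comp (h : ContLin Q R) (k : ContLin P Q) : ContLin P R)
  add_left h h' k := rfl
  smul_left r h k := rfl
  add_right h k k' := ContLin.ext fun x => map_add (F := ContLin Q R) h _ _
  smul_right r h k := ContLin.ext fun x => map_smul (F := ContLin Q R) h r _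
  cont_left k s h hs h1 hh := ContLin.isSeqLub_of_apply fun x =>
    ContLin.isSeqLub_apply hs h1 hh _
  cont_right h s k hs h1 hk := ContLin.isSeqLub_of_apply fun x =>
    ContLin.cont_of_bdd (h : ContLin Q R) (ContLin.monoSeq_apply hs x)
      (fun n => ContLin.nrm_apply_le_of_opNrm_le_one (h1 n) x) (ContLin.isSeqLub_apply hs h1 hk x)
  nrm_le_one h k hh hk := ContLin.opNrm_le fun x hx =>
    ((ContLin.nrm_apply_le_of_opNrm_le_one hh _).trans
      (ContLin.nrm_apply_le_of_opNrm_le_one hk _)).trans hx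

/-- In a complete cone, multiplication of a fixed element by scalars is continuous: if `a` is the
supremum of `s n`, the difference between `a • x` and the least upper bound of `s n • x` has norm
at most `(a - s n) * ‖x‖` for all `n`. -/
lemma isSeqLub_smul_left {P : SCCLin.{u}} (x : P) {s : ℕ → ℝ≥0} {a : ℝ≥0} (hs : Monotone s)
    (ha : IsLUB (Set.range s) a) : IsSeqLub (fun n => s n • x) (a • x) := by
  have hmono : ∀ {b c : ℝ≥0}, b ≤ c → ConeLE (b • x) (c • x) := fun {b c} h =>
    ⟨(c - b) • x, by rw [← add_smul, add_tsub_cancel_of_le h]⟩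
  have hle : ∀ n, s n ≤ a := fun n => ha.1 ⟨n, rfl⟩
  obtain ⟨z, hz⟩ := CompleteCone.exists_lub_of_bdd (s := fun n => s n • x) (r := a * nrm x)
    (fun m n h => hmono (hs h)) (fun n => by
      rw [PositiveCone.nrm_smul]
      exact mul_le_mul_left (hle n) _)
  obtain ⟨w, hw⟩ := hz.2 (a • x) fun n => hmono (hle n)
  have hwn : ∀ n, nrm w ≤ (a - s n) * nrm x := fun n => by
    obtain ⟨d, hd⟩ := hz.1 n
    have h1 : ConeLE w ((a - s n) • x) := by
      refine ⟨d, PositiveCone.cancel _ _ (s n • x) ?_⟩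
      calc w + d + s n • x = (s n • x + d) + w := by abel
        _ = a • x := by rw [hd, hw]
        _ = (a - s n) • x + s n • x := by rw [← add_smul, tsub_add_cancel_of_le (hle n)]
    rw [← PositiveCone.nrm_smul]
    exact h1.nrm_le
  have hlim : Filter.Tendsto (fun n => (a - s n) * nrm x) Filter.atTop (nhds ((a - a) * nrm x)) :=
    ((tendsto_const_nhds).sub (tendsto_atTop_isLUB hs ha)).mul_const _
  have hw0 : nrm w ≤ 0 := by
    have := ge_of_tendsto' hlim hwn
    rwa [tsub_self, zero_mul] at this
  have : w = 0 := PositiveCone.eq_zero_of_nrm_eq_zero _ (le_antisymm hw0 zero_le)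
  rw [← hw, this, add_zero]
  exact hz

/-- Scalar multiplication `(r, x) ↦ r x` as a bilinear map. -/
noncomputable def smulBilin (P : SCCLin.{u}) : Bilin unit P P where
  toFun (r : ULift.{u} ℝ≥0) x := r.down • x
  add_left _ _ _ := add_smul _ _ _
  smul_left _ _ _ := mul_smul _ _ _
  add_right _ _ _ := smul_add _ _ _
  smul_right _ _ _ := smul_comm _ _ _
  cont_left x := fun s a hs h1 ha =>
    isSeqLub_smul_left x (s := fun n => (s n : ULift.{u} ℝ≥0).down) (a := (a : ULift.{u} ℝ≥0).down)
      (fun m n h => coneLE_ulift.1 (hs m n h))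
      ⟨by rintro _ ⟨n, rfl⟩; exact coneLE_ulift.1 (ha.1 n), fun b hb =>
        coneLE_ulift.1 (ha.2 (⟨b⟩ : ULift.{u} ℝ≥0) fun n => coneLE_ulift.2 (hb ⟨n, rfl⟩))⟩
  cont_right r s x hs h1 hx := by
    rcases eq_or_ne (r : ULift.{u} ℝ≥0).down 0 with h | h
    · simp only [h, zero_smul]
      exact ContLin.isSeqLub_const 0
    · exact hx.smul h
  nrm_le_one r x hr hx := by
    rw [PositiveCone.nrm_smul]
    exact (mul_le_mul' hr hx).trans (mul_one 1).le

end SCCLin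

namespace ConeTensor

open SCCLin

variable (T : ConeTensor.{u}) (P Q R : SCCLin.{u})

/-- The symmetry, as a morphism. -/
noncomputable def symmHom : T.obj P Q ⟶ T.obj Q P := T.lift (T.tmulBilin Q P).flip

variable {P Q R} in
lemma symmHom_tmul (x : P) (y : Q) : T.symmHom P Q (T.tmul x y) = T.tmul y x := lift_tmul _ x y

/-- The symmetry `x ⊗ y ↦ y ⊗ x`. -/
noncomputable def symmIso : T.obj P Q ≅ T.obj Q P where
  hom := T.symmHom P Q
  inv := T.symmHom Q P
  hom_inv_id := hom_ext fun x y => by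
    rw [comp_apply, symmHom_tmul, symmHom_tmul]; rfl
  inv_hom_id := hom_ext fun x y => by
    rw [comp_apply, symmHom_tmul, symmHom_tmul]; rfl

/-- The associator as a morphism: by adjunction, it corresponds to the morphism from `P` to
`Q ⊸ (R ⊸ (P ⊗ (Q ⊗ R)))` which maps `x` to `y ↦ z ↦ x ⊗ (y ⊗ z)`. -/
noncomputable def assocHom : T.obj (T.obj P Q) R ⟶ T.obj P (T.obj Q R) :=
  (T.curry _ _ _).symm <| (T.curry _ _ _).symm <|
    T.curry _ _ _ (𝟙 (T.obj P (T.obj Q R))) ≫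
      (compBilin R (T.obj Q R) (T.obj P (T.obj Q R))).transpose ≫
        linHomMap (T.curry _ _ _ (𝟙 (T.obj Q R))) (𝟙 _)

variable {P Q R} in
lemma assocHom_tmul (x : P) (y : Q) (z : R) :
    T.assocHom P Q R (T.tmul (T.tmul x y) z) = T.tmul x (T.tmul y z) := by
  unfold assocHom
  rw [curry_symm_tmul, curry_symm_tmul]
  rfl

/-- The inverse of the associator, which is obtained from the associator by conjugation with
symmetries. -/
noncomputable def assocInv : T.obj P (T.obj Q R) ⟶ T.obj (T.obj P Q) R :=
  T.symmHom _ _ ≫ T.map (T.symmHom Q R) (𝟙 P) ≫ T.assocHom R Q P ≫ T.symmHom _ _ ≫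
    T.map (T.symmHom Q P) (𝟙 R)

variable {P Q R} in
lemma assocInv_tmul (x : P) (y : Q) (z : R) :
    T.assocInv P Q R (T.tmul x (T.tmul y z)) = T.tmul (T.tmul x y) z := by
  simp only [assocInv, comp_apply, symmHom_tmul, map_tmul, assocHom_tmul, id_apply]

variable {T P Q R} in
lemma hom_ext₃_right {S : SCCLin.{u}} {g h : T.obj P (T.obj Q R) ⟶ S}
    (H : ∀ x y z, g (T.tmul x (T.tmul y z)) = h (T.tmul x (T.tmul y z))) : g = h :=
  (cancel_epi (T.symmIso (T.obj Q R) P).hom).1 <| hom_ext₃ fun y z x => by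
    simp only [comp_apply, symmIso, symmHom_tmul, H]

/-- The associator `(x ⊗ y) ⊗ z ↦ x ⊗ (y ⊗ z)`. -/
noncomputable def assocIso : T.obj (T.obj P Q) R ≅ T.obj P (T.obj Q R) where
  hom := T.assocHom P Q R
  inv := T.assocInv P Q R
  hom_inv_id := hom_ext₃ fun x y z => by
    rw [comp_apply, assocHom_tmul, assocInv_tmul]; rfl
  inv_hom_id := hom_ext₃_right fun x y z => by
    rw [comp_apply, assocInv_tmul, assocHom_tmul]; rfl

/-- The left unitor `r ⊗ x ↦ r x`, with inverse `x ↦ 1 ⊗ x`. -/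
noncomputable def leftUnitorIso : T.obj unit P ≅ P where
  hom := T.lift (smulBilin P)
  inv := Hom.mk (T.curry _ _ _ (𝟙 (T.obj unit P)) (scalar 1))
    fun x hx => (T.tmulBilin unit P).nrm_le_one (scalar 1) x le_rfl hx
  hom_inv_id := hom_ext fun r x => by
    rw [comp_apply, lift_tmul]
    change T.tmul (scalar 1) ((r : ULift.{u} ℝ≥0).down • x) = T.tmul r x
    have h := (T.tmulBilin unit P).smul_right (r : ULift.{u} ℝ≥0).down (scalar 1) x
    refine h.trans
      (((T.tmulBilin unit P).smul_left (r : ULift.{u} ℝ≥0).down (scalar 1) x).symm.trans ?_)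
    exact congrArg (fun s => T.tmul s x)
      (ULift.ext _ _ (mul_one (r : ULift.{u} ℝ≥0).down))
  inv_hom_id := SCCLin.hom_ext fun x => (lift_tmul (smulBilin P) (scalar 1) x).trans (one_smul _ x)

/-- The right unitor `x ⊗ r ↦ r x`. -/
noncomputable def rightUnitorIso : T.obj P unit ≅ P := T.symmIso P unit ≪≫ T.leftUnitorIso P

variable {P}

lemma leftUnitorIso_tmul (r : ℝ≥0) (x : P) :
    (T.leftUnitorIso P).hom (T.tmul (scalar r) x) = r • x := lift_tmul (smulBilin P) (scalar r) x

lemma rightUnitorIso_tmul (x : P) (r : ℝ≥0) :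
    (T.rightUnitorIso P).hom (T.tmul x (scalar r)) = r • x := by
  rw [rightUnitorIso, Iso.trans_hom, comp_apply]
  exact (congrArg (fun t => (T.leftUnitorIso P).hom t) (T.symmHom_tmul x (scalar r))).trans
    (T.leftUnitorIso_tmul r x)

/-- The natural isomorphisms given by the universal property. -/
noncomputable def coherence : T.Coherence where
  assoc := T.assocIso
  assoc_natural f g h := hom_ext₃ fun x y z => by
    simp only [comp_apply, map_tmul, assocIso, assocHom_tmul]
  leftUnitor := T.leftUnitorIso
  leftUnitor_natural f := hom_ext fun r x => by
    rw [comp_apply, comp_apply, map_tmul]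
    exact (T.leftUnitorIso_tmul r.down (f x)).trans ((map_smul f.toContLin r.down x).symm.trans
      (congrArg f.toContLin (T.leftUnitorIso_tmul r.down x).symm))
  rightUnitor := T.rightUnitorIso
  rightUnitor_natural f := hom_ext fun x r => by
    rw [comp_apply, comp_apply, map_tmul]
    exact (T.rightUnitorIso_tmul (f x) r.down).trans ((map_smul f.toContLin r.down x).symm.trans
      (congrArg f.toContLin (T.rightUnitorIso_tmul x r.down).symm))
  symm := T.symmIso
  symm_natural f g := hom_ext fun x y => by
    simp only [comp_apply, map_tmul, symmIso, symmHom_tmul]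

lemma coherence_onPureTensors : T.coherence.OnPureTensors where
  assoc _ _ _ := T.assocHom_tmul
  leftUnitor _ := T.leftUnitorIso_tmul
  rightUnitor _ := T.rightUnitorIso_tmul
  symm _ _ := T.symmHom_tmul

lemma coherence_isSymmetricMonoidal : T.coherence.IsSymmetricMonoidal where
  pentagon P Q R S := hom_ext₄ fun x y z w => by
    simp only [comp_apply, map_tmul, coherence, assocIso, assocHom_tmul, id_apply]
  triangle P Q := hom_ext₃ fun x r y => by
    rw [comp_apply, map_tmul]
    change T.map (𝟙 P) (T.leftUnitorIso Q).hom (T.assocHom P unit Q _) = _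
    rw [assocHom_tmul, map_tmul]
    change T.tmul x ((T.leftUnitorIso Q).hom (T.tmul (scalar r.down) y)) =
      T.tmul ((T.rightUnitorIso P).hom (T.tmul x (scalar r.down))) y
    rw [leftUnitorIso_tmul, rightUnitorIso_tmul]
    exact ((T.tmulBilin P Q).smul_right r.down x y).trans
      ((T.tmulBilin P Q).smul_left r.down x y).symm
  hexagon P Q R := hom_ext₃ fun x y z => by
    simp only [comp_apply, map_tmul, coherence, assocIso, assocHom_tmul, symmIso, symmHom_tmul,
      id_apply]
  symmetry P Q := (T.symmIso P Q).hom_inv_id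

end ConeTensor

/-! ### Cones of probabilistic coherence spaces and cubes -/

namespace PCS

open SCCLin

variable {X : PCS.{u}}

lemma mem_cone_single [DecidableEq X.web] (a : X.web) : Pi.single a 1 ∈ X.coneSubmodule := by
  obtain ⟨x, hx, hxa⟩ := X.pos a
  rw [mem_cone_iff]
  have h1 : X.enrm ((x a)⁻¹ • x) ≠ ⊤ := by
    rw [enrm_smul]
    exact ENNReal.mul_ne_top ENNReal.coe_ne_top
      (ne_top_of_le_ne_top ENNReal.one_ne_top (mem_coh_iff.1 hx))
  refine ne_top_of_le_ne_top h1 (enrm_mono fun b => ?_)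
  rcases eq_or_ne b a with rfl | h
  · simp [hxa.ne']
  · simp [Pi.single_eq_of_ne h]

open Classical in
/-- The basis vector at a point of the web, which is `1` there and `0` elsewhere. -/
noncomputable def basisVec (a : X.web) : Cl X :=
  (⟨Pi.single a 1, mem_cone_single a⟩ : X.coneSubmodule)

/-- The value of an element of `Cl X` at a point of the web. -/
def val (x : Cl X) (a : X.web) : ℝ≥0 := (show X.coneSubmodule from x).1 a

lemma ext_val {x y : Cl X} (h : ∀ a, val x a = val y a) : x = y := Subtype.ext (funext h)

lemma val_add (x y : Cl X) (a : X.web) : val (x + y) a = val x a + val y a := rfl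

lemma val_smul (r : ℝ≥0) (x : Cl X) (a : X.web) : val (r • x) a = r * val x a := rfl

lemma val_sum {ι : Type*} (F : Finset ι) (f : ι → Cl X) (a : X.web) :
    val (∑ i ∈ F, f i) a = ∑ i ∈ F, val (f i) a := by
  classical
  induction F using Finset.induction_on with
  | empty => rfl
  | insert i F hi ih => rw [Finset.sum_insert hi, Finset.sum_insert hi, val_add, ih]

open Classical in
lemma val_basisVec (a b : X.web) : val (basisVec a) b = if b = a then 1 else 0 :=
  Pi.single_apply a 1 b

/-- The coordinate form `x ↦ x a`. -/
def coord (a : X.web) : ContLin (Cl X) ℝ≥0 where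
  toFun x := val x a
  map_add' x y := val_add x y a
  map_smul' r x := val_smul r x a
  cont s x hs h1 hx := by
    have := isLUB_apply hs h1 hx a
    exact ⟨fun n => coneLE_nnreal.2 (this.1 ⟨n, rfl⟩), fun r hr => coneLE_nnreal.2
      (this.2 (by rintro _ ⟨n, rfl⟩; exact coneLE_nnreal.1 (hr n)))⟩

lemma coneLE_iff_val {x y : Cl X} : ConeLE x y ↔ ∀ a, val x a ≤ val y a :=
  coneLE_iff (X := X)

/-- Exhaustion of the web by finite sets. -/
lemma exists_exhaustion (X : PCS.{u}) :
    ∃ F : ℕ → Finset X.web, Monotone F ∧ ∀ a, ∃ n, a ∈ F n := by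
  have := X.countable_web
  obtain ⟨f, hf⟩ := exists_injective_nat X.web
  refine ⟨fun n => (Finset.range n).preimage f hf.injOn, fun m n h a ha => ?_,
    fun a => ⟨f a + 1, ?_⟩⟩
  · simp only [Finset.mem_preimage, Finset.mem_range] at ha ⊢
    exact ha.trans_le h
  · simp

lemma coneLE_sum {P : Type v} [AddCommMonoid P] {ι : Type*} {F G : Finset ι} (h : F ⊆ G)
    (f : ι → P) : ConeLE (∑ i ∈ F, f i) (∑ i ∈ G, f i) := by
  classical
  exact ⟨∑ i ∈ G \ F, f i, by rw [add_comm, Finset.sum_sdiff h]⟩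

open Classical in
lemma val_truncation (x : Cl X) (F : Finset X.web) (a : X.web) :
    val (∑ b ∈ F, val x b • basisVec b) a = if a ∈ F then val x a else 0 := by
  simp [val_sum, val_smul, val_basisVec]

/-- Linear and continuous maps out of `Cl X` are determined by the basis vectors, because every
element is the least upper bound of its finite truncations. -/
lemma contLin_ext {R : SCCLin.{u}} {g h : ContLin (Cl X) R}
    (H : ∀ a, g (basisVec a) = h (basisVec a)) : g = h := by
  classical
  refine ContLin.ext fun x => ?_
  obtain ⟨F, hF, hcov⟩ := X.exists_exhaustion
  let s : ℕ → Cl X := fun n => ∑ b ∈ F n, val x b • basisVec b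
  have hs : IsMonoSeq s := fun m n hmn => coneLE_sum (hF hmn) _
  have hle : ∀ n, ConeLE (s n) x := fun n => coneLE_iff_val.2 fun a => by
    rw [val_truncation]
    split_ifs
    exacts [le_rfl, zero_le]
  have hx : IsSeqLub s x := ⟨hle, fun y hy => coneLE_iff_val.2 fun a => by
    obtain ⟨n, hn⟩ := hcov a
    have := coneLE_iff_val.1 (hy n) a
    rwa [val_truncation, if_pos hn] at this⟩
  have key : ∀ n, g (s n) = h (s n) := fun n => by
    simp only [s, map_sum, map_smul, H]
  have hg := g.cont_of_bdd hs (fun n => (hle n).nrm_le) hx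
  have hh := h.cont_of_bdd hs (fun n => (hle n).nrm_le) hx
  simp only [key] at hg
  exact hg.unique hh

lemma hom_ext {R : SCCLin.{u}} {g h : Cl X ⟶ R}
    (H : ∀ a, g (basisVec a) = h (basisVec a)) : g = h := by
  have := contLin_ext (g := Hom.toContLin g) (h := Hom.toContLin h) H
  exact SCCLin.hom_ext fun x => DFunLike.congr_fun this x

lemma IsCube.nrm_le_one_iff (hX : X.IsCube) {x : Cl X} : nrm x ≤ 1 ↔ ∀ a, val x a ≤ 1 := by
  refine (PCS.nrm_le_one_iff (X := X)).trans ?_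
  rw [hX]
  rfl

/-- The map `r ↦ r • x` as a linear and continuous map. -/
def smulRight {R : SCCLin.{u}} (x : R) : ContLin ℝ≥0 R where
  toFun r := r • x
  map_add' r r' := add_smul r r' x
  map_smul' r r' := mul_smul r r' x
  cont s a hs h1 ha := isSeqLub_smul_left x (fun m n h => coneLE_nnreal.1 (hs m n h))
    ⟨by rintro _ ⟨n, rfl⟩; exact coneLE_nnreal.1 (ha.1 n), fun b hb =>
      coneLE_nnreal.1 (ha.2 b fun n => coneLE_nnreal.2 (hb ⟨n, rfl⟩))⟩

lemma contLin_sum_apply {P Q : SCCLin.{u}} {ι : Type*} (F : Finset ι) (f : ι → ContLin P Q)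
    (x : P) : (∑ i ∈ F, f i) x = ∑ i ∈ F, f i x := by
  classical
  induction F using Finset.induction_on with
  | empty => rfl
  | insert i F hi ih => rw [Finset.sum_insert hi, Finset.sum_insert hi, ContLin.add_apply, ih]

/-- The cone of a cube is freely generated by its basis vectors, subject to the condition that all
their finite sums have norm at most `1`. -/
lemma IsCube.exists_hom (hX : X.IsCube) {R : SCCLin.{u}} (r : X.web → R)
    (hr : ∀ F : Finset X.web, nrm (∑ a ∈ F, r a) ≤ 1) :
    ∃ g : Cl X ⟶ R, ∀ a, g (basisVec a) = r a := by
  classical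
  obtain ⟨F, hF, hcov⟩ := X.exists_exhaustion
  let s : ℕ → ContLin (Cl X) R := fun n => ∑ a ∈ F n, (smulRight (r a)).comp (coord a)
  have hs_apply : ∀ n x, s n x = ∑ a ∈ F n, val x a • r a := fun n x => contLin_sum_apply _ _ _
  have hs : IsMonoSeq s := fun m n h => coneLE_sum (hF h) _
  have h1 : ∀ n, nrm (s n) ≤ 1 := fun n => ContLin.opNrm_le fun x hx => by
    rw [hs_apply]
    refine ConeLE.nrm_le (y := ∑ a ∈ F n, r a) ⟨∑ a ∈ F n, (1 - val x a) • r a, ?_⟩ |>.trans (hr _)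
    rw [← Finset.sum_add_distrib]
    refine Finset.sum_congr rfl fun a _ => ?_
    rw [← add_smul, add_tsub_cancel_of_le (hX.nrm_le_one_iff.1 hx a), one_smul]
  obtain ⟨f, hf1, hf⟩ := ContLin.exists_pointwise_lub hs h1
  refine ⟨SCCLin.Hom.mk f fun x hx => (ContLin.nrm_apply_le_of_opNrm_le_one hf1 x).trans hx,
    fun a => ?_⟩
  refine IsSeqLub.unique (hf (basisVec a)) ?_
  have hval : ∀ n, s n (basisVec a) = if a ∈ F n then r a else 0 := fun n => by
    simp [hs_apply, val_basisVec]
  simp only [hval]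
  refine ⟨fun n => ?_, fun y hy => ?_⟩
  · beta_reduce
    split_ifs
    exacts [ConeLE.refl _, ⟨r a, zero_add _⟩]
  · obtain ⟨n, hn⟩ := hcov a
    exact (if_pos hn : (if a ∈ F n then r a else 0) = r a) ▸ hy n

lemma isCube_one : one.{u}.IsCube := rfl

/-- The tensors of two unit cubes contain the family that is constantly `1`, so their bipolar is a
unit cube. -/
lemma pcsOrth_pcsOrth_pureTensors_cube (I J : Type u) :
    pcsOrth (pcsOrth (pureTensors {x : I → ℝ≥0 | ∀ a, x a ≤ 1} {y : J → ℝ≥0 | ∀ b, y b ≤ 1})) =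
      {z | ∀ p, z p ≤ 1} := by
  classical
  refine Set.Subset.antisymm (fun z hz p => ?_) (fun z hz w hw => ?_)
  · have h := hz (Pi.single p 1) (by
      rintro _ ⟨x, hx, y, hy, rfl⟩
      rw [pcsPairing_single, ENNReal.coe_one, mul_one, ENNReal.coe_le_one_iff]
      exact mul_le_one' (hx p.1) (hy p.2))
    rw [pcsPairing_comm, pcsPairing_single, ENNReal.coe_one, mul_one, ENNReal.coe_le_one_iff] at h
    exact h
  · have h := hw (pureTensor (fun _ => 1) (fun _ => 1))
      ⟨_, fun _ => le_rfl, _, fun _ => le_rfl, rfl⟩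
    rw [pcsPairing_comm]
    refine (pcsPairing_mono (fun p => ?_) w).trans h
    exact (hz p).trans (mul_one 1).ge

lemma IsCube.tensor {X Y : PCS.{u}} (hX : X.IsCube) (hY : Y.IsCube) : (tensor X Y).IsCube := by
  change pcsOrth (pcsOrth (pureTensors X.coh Y.coh)) = _
  rw [hX, hY]
  exact pcsOrth_pcsOrth_pureTensors_cube _ _

lemma val_tensorBilin {X Y : PCS.{u}} (x : Cl X) (y : Cl Y) (p : X.web × Y.web) :
    val (X := PCS.tensor X Y) (tensorBilin X Y x y) p = val x p.1 * val y p.2 := rfl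

lemma val_toCl_ofEquiv {X Y : PCS.{u}} (e : X.web ≃ Y.web)
    (h : ∀ x ∈ X.coh, (fun b => x (e.symm b)) ∈ Y.coh) (x : Cl X) (b : Y.web) :
    val ((Hom.ofEquiv e h).toCl x) b = val x (e.symm b) := by
  change (matApp (Hom.ofEquiv e h).mat _ b).toNNReal = _
  unfold matApp
  rw [tsum_eq_single (e.symm b)]
  · simp [Hom.ofEquiv, val]
  · intro a ha
    have : e a ≠ b := fun hab => ha (by rw [← hab, e.symm_apply_apply])
    simp [Hom.ofEquiv, this]

lemma val_assocHom_toCl (X Y Z : PCS.{u}) (t : Cl (PCS.tensor (PCS.tensor X Y) Z))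
    (p : X.web × Y.web × Z.web) :
    val (X := PCS.tensor X (PCS.tensor Y Z)) ((assocHom X Y Z).toCl t) p =
      val (X := PCS.tensor (PCS.tensor X Y) Z) t ((p.1, p.2.1), p.2.2) :=
  val_toCl_ofEquiv (X := PCS.tensor (PCS.tensor X Y) Z) (Y := PCS.tensor X (PCS.tensor Y Z))
    (Equiv.prodAssoc X.web Y.web Z.web) _ t p

lemma val_leftUnitorHom_toCl (X : PCS.{u}) (t : Cl (PCS.tensor one X)) (a : X.web) :
    val ((leftUnitorHom X).toCl t) a = val (X := PCS.tensor one X) t (PUnit.unit, a) :=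
  val_toCl_ofEquiv (X := PCS.tensor one X) (Equiv.punitProd X.web) _ t a

lemma val_rightUnitorHom_toCl (X : PCS.{u}) (t : Cl (PCS.tensor X one)) (a : X.web) :
    val ((rightUnitorHom X).toCl t) a = val (X := PCS.tensor X one) t (a, PUnit.unit) :=
  val_toCl_ofEquiv (X := PCS.tensor X one) (Equiv.prodPUnit X.web) _ t a

lemma val_symmHom_toCl (X Y : PCS.{u}) (t : Cl (PCS.tensor X Y)) (p : Y.web × X.web) :
    val (X := PCS.tensor Y X) ((symmHom X Y).toCl t) p =
      val (X := PCS.tensor X Y) t (p.2, p.1) :=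
  val_toCl_ofEquiv (X := PCS.tensor X Y) (Y := PCS.tensor Y X) (Equiv.prodComm X.web Y.web) _ t p

/-- The generator `1` of the cone `Cl 1 ≅ ℝ≥0` can be mapped to any element of the unit ball, so
every element of a cone is in the image of some morphism from `Cl 1`. -/
lemma exists_hom_one_apply_eq {P : SCCLin.{u}} (x : P) :
    ∃ (f : Cl one.{u} ⟶ P) (a : Cl one.{u}), f a = x := by
  have hc : nrm x + 1 ≠ 0 := by positivity
  obtain ⟨f, hf⟩ := isCube_one.{u}.exists_hom (fun _ => (nrm x + 1)⁻¹ • x)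
    (fun F : Finset PUnit.{u + 1} => by
      have hF : F ⊆ {PUnit.unit} := fun a _ => Finset.mem_singleton_self _
      refine (coneLE_sum hF _).nrm_le.trans ?_
      rw [Finset.sum_singleton, PositiveCone.nrm_smul, inv_mul_le_iff₀ (by positivity), mul_one]
      exact le_self_add)
  refine ⟨f, (nrm x + 1) • basisVec (X := one) PUnit.unit, ?_⟩
  rw [map_smul]
  exact (congrArg (fun z => (nrm x + 1) • z) (hf PUnit.unit)).trans (smul_inv_smul₀ hc x)

end PCS

/-! ### The comparison with probabilistic coherence spaces -/

namespace ConeTensor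

open SCCLin

variable (T : ConeTensor.{u})

lemma sum_tmul_sum {P Q : SCCLin.{u}} {ι κ : Type*} (F : Finset ι) (G : Finset κ) (x : ι → P)
    (y : κ → Q) :
    ∑ p ∈ F ×ˢ G, T.tmul (x p.1) (y p.2) = T.tmul (∑ i ∈ F, x i) (∑ j ∈ G, y j) := by
  have hl : ∀ y, T.tmul (∑ i ∈ F, x i) y = ∑ i ∈ F, T.tmul (x i) y := fun y =>
    map_sum (G := ContLin P (T.obj P Q)) (Hom.toContLin (T.tmulBilin P Q).flip.transpose y) _ _
  have hr : ∀ x, T.tmul x (∑ j ∈ G, y j) = ∑ j ∈ G, T.tmul x (y j) := fun x =>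
    map_sum (G := ContLin Q (T.obj P Q)) (Hom.toContLin (T.tmulBilin P Q).transpose x) _ _
  rw [Finset.sum_product, hl]
  simp only [hr]

/-- For cubes, the inverse of the comparison maps the basis vector at `(a, b)` to the tensor of the
basis vectors at `a` and `b`; the norm condition holds since the sum of these tensors over a
rectangle `F × G` is the tensor of two elements of the unit balls. -/
lemma isIso_clComparison {X Y : PCS.{u}} (hX : X.IsCube) (hY : Y.IsCube) :
    IsIso (T.clComparison X Y) := by
  classical
  have hsum : ∀ {Z : PCS.{u}} (hZ : Z.IsCube) (F : Finset Z.web),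
      nrm (∑ a ∈ F, PCS.basisVec a) ≤ 1 := fun {Z} hZ F => hZ.nrm_le_one_iff.2 fun b => by
    rw [PCS.val_sum]
    simp only [PCS.val_basisVec, Finset.sum_ite_eq]
    split_ifs
    exacts [le_rfl, zero_le]
  obtain ⟨g, hg⟩ := (hX.tensor hY).exists_hom (R := T.obj (PCS.Cl X) (PCS.Cl Y))
    (fun p : X.web × Y.web => T.tmul (PCS.basisVec p.1) (PCS.basisVec p.2))
    (fun F : Finset (X.web × Y.web) => by
      refine (PCS.coneLE_sum F.subset_product _).nrm_le.trans ?_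
      rw [sum_tmul_sum]
      exact (T.tmulBilin _ _).nrm_le_one _ _ (hsum hX _) (hsum hY _))
  have hm : ∀ p : X.web × Y.web, T.clComparison X Y
      (T.tmul (PCS.basisVec p.1) (PCS.basisVec p.2)) = PCS.basisVec (X := PCS.tensor X Y) p :=
    fun p => by
      rw [clComparison, lift_tmul]
      refine PCS.ext_val (X := PCS.tensor X Y) fun q => ?_
      refine (PCS.val_tensorBilin _ _ q).trans
        (Eq.trans ?_ (PCS.val_basisVec (X := PCS.tensor X Y) p q).symm)
      rw [PCS.val_basisVec, PCS.val_basisVec, mul_ite, mul_one, mul_zero, ← ite_and]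
      exact if_congr ((and_comm).trans Prod.ext_iff.symm) rfl rfl
  refine ⟨g, ?_, PCS.hom_ext (X := PCS.tensor X Y) fun p => ?_⟩
  · refine (T.curry _ _ _).injective (PCS.hom_ext fun a => PCS.contLin_ext fun b => ?_)
    refine (curry_apply _ _ _).trans (Eq.trans ?_ (curry_apply _ _ _).symm)
    exact (congrArg (Hom.toContLin g) (hm (a, b))).trans (hg (a, b))
  · exact (congrArg (Hom.toContLin (T.clComparison X Y)) (hg p)).trans (hm p)

lemma clComparison_tmul {X Y : PCS.{u}} (x : PCS.Cl X) (y : PCS.Cl Y) :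
    T.clComparison X Y (T.tmul x y) = PCS.tensorBilin X Y x y := lift_tmul _ x y

lemma coherence_extendsPCS (K : PCS.{u} → Prop) : T.coherence.ExtendsPCS K where
  assoc X Y Z _ _ _ := hom_ext₃ fun x y z => by
    simp only [comp_apply, map_tmul, coherence, assocIso, assocHom_tmul, clComparison_tmul,
      id_apply]
    refine PCS.ext_val fun p => ?_
    refine Eq.trans ?_ (PCS.val_assocHom_toCl X Y Z _ p).symm
    exact (mul_assoc (PCS.val x p.1) (PCS.val y p.2.1) (PCS.val z p.2.2)).symm
  leftUnitor X _ := hom_ext fun r x => by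
    simp only [comp_apply, map_tmul, clComparison_tmul, id_apply]
    refine (T.leftUnitorIso_tmul r.down x).trans (PCS.ext_val fun p => ?_)
    refine Eq.trans ?_ (PCS.val_leftUnitorHom_toCl X _ p).symm
    rfl
  rightUnitor X _ := hom_ext fun x r => by
    simp only [comp_apply, map_tmul, clComparison_tmul, id_apply]
    refine (T.rightUnitorIso_tmul x r.down).trans (PCS.ext_val fun p => ?_)
    refine Eq.trans ?_ (PCS.val_rightUnitorHom_toCl X _ p).symm
    exact mul_comm r.down (PCS.val x p)
  symm X Y _ _ := hom_ext fun x y => by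
    simp only [comp_apply, coherence, symmIso, symmHom_tmul, clComparison_tmul]
    refine PCS.ext_val fun p => ?_
    refine Eq.trans ?_ (PCS.val_symmHom_toCl X Y _ p).symm
    exact mul_comm (PCS.val y p.1) (PCS.val x p.2)

variable {T}

/-- A natural isomorphism on tensor products is determined by its component at copies of `Cl 1`,
because every element of a cone is in the image of a morphism from `Cl 1`; there, the compatibility
with the comparison morphisms, which are invertible for cubes, leaves no choice. -/
lemma Coherence.ExtendsPCS.unique {c c' : T.Coherence} (h : c.ExtendsPCS PCS.IsCube)
    (h' : c'.ExtendsPCS PCS.IsCube) : c' = c := by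
  have h1 := PCS.isCube_one.{u}
  have := T.isIso_clComparison h1 h1
  have := T.isIso_clComparison h1 (h1.tensor h1)
  have hassoc1 := (h'.assoc _ _ _ h1 h1 h1).trans (h.assoc _ _ _ h1 h1 h1).symm
  have hm : IsIso (T.map (𝟙 (PCS.Cl PCS.one)) (T.clComparison PCS.one PCS.one)) := by
    refine ⟨T.map (𝟙 _) (inv (T.clComparison PCS.one PCS.one)), ?_, ?_⟩ <;>
    · refine (T.functor.map_comp _ _).symm.trans (Eq.trans ?_ (T.functor.map_id _))
      congr 1
      simp
  rw [cancel_mono] at hassoc1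
  have hsymm1 := (h'.symm _ _ h1 h1).trans (h.symm _ _ h1 h1).symm
  rw [cancel_mono] at hsymm1
  have hassoc : c'.assoc = c.assoc := funext fun P => funext fun Q => funext fun R =>
    Iso.ext <| hom_ext₃ fun x y z => by
      obtain ⟨f, x, rfl⟩ := PCS.exists_hom_one_apply_eq x
      obtain ⟨g, y, rfl⟩ := PCS.exists_hom_one_apply_eq y
      obtain ⟨k, z, rfl⟩ := PCS.exists_hom_one_apply_eq z
      rw [← map_tmul, ← map_tmul, ← comp_apply, ← comp_apply, c'.assoc_natural, c.assoc_natural]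
      rw [comp_apply, comp_apply, hassoc1]
  have hleft : c'.leftUnitor = c.leftUnitor := funext fun P => Iso.ext <| hom_ext fun r x => by
      obtain ⟨f, x, rfl⟩ := PCS.exists_hom_one_apply_eq x
      rw [← id_apply (X := unit) r, ← map_tmul, ← comp_apply, ← comp_apply, c'.leftUnitor_natural,
        c.leftUnitor_natural, h.leftUnitor _ h1, h'.leftUnitor _ h1]
  have hright : c'.rightUnitor = c.rightUnitor := funext fun P => Iso.ext <| hom_ext fun x r => by
      obtain ⟨f, x, rfl⟩ := PCS.exists_hom_one_apply_eq x
      rw [← id_apply (X := unit) r, ← map_tmul, ← comp_apply, ← comp_apply, c'.rightUnitor_natural,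
        c.rightUnitor_natural, h.rightUnitor _ h1, h'.rightUnitor _ h1]
  have hsymm : c'.symm = c.symm := funext fun P => funext fun Q => Iso.ext <| hom_ext fun x y => by
      obtain ⟨f, x, rfl⟩ := PCS.exists_hom_one_apply_eq x
      obtain ⟨g, y, rfl⟩ := PCS.exists_hom_one_apply_eq y
      rw [← map_tmul, ← comp_apply, ← comp_apply, c'.symm_natural, c.symm_natural, hsymm1]
  cases c
  cases c'
  simp only at hassoc hleft hright hsymm
  subst hassoc hleft hright hsymm
  rfl

/-! ### The closed structure -/

variable (T) in
/-- The bijection `SCCLin(P ⊗ Q, R) ≃ SCCLin(P, Q ⊸ R)` as an adjunction. -/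
noncomputable def adjunction (P : SCCLin.{u}) :
    letI := Coherence.monoidalCategory T.coherence_isSymmetricMonoidal
    MonoidalCategory.tensorRight P ⊣ linHomFunctor.obj (Opposite.op P) :=
  letI := Coherence.monoidalCategory T.coherence_isSymmetricMonoidal
  Adjunction.mkOfHomEquiv
    { homEquiv := fun Q R => T.curry Q P R
      homEquiv_naturality_left_symm := fun {Q Q' R} f g => hom_ext fun x y => by
        refine (curry_symm_tmul _ x y).trans (Eq.symm ?_)
        exact (congrArg (Hom.toContLin ((T.curry Q' P R).symm g)) (map_tmul f (𝟙 P) x y)).trans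
          (curry_symm_tmul _ _ _)
      homEquiv_naturality_right := fun {Q R R'} f g =>
        SCCLin.hom_ext fun x => linHom_ext fun y => by
        refine (curry_apply _ _ _).trans ?_
        exact congrArg (Hom.toContLin g) (curry_apply f x y).symm }

variable (T) in
lemma adjunction_counit_app (P Q : SCCLin.{u}) :
    letI := Coherence.monoidalCategory T.coherence_isSymmetricMonoidal
    (T.adjunction P).counit.app Q = T.ev P Q := by
  let := Coherence.monoidalCategory T.coherence_isSymmetricMonoidal
  exact Adjunction.mkOfHomEquiv_counit_app _ _

end ConeTensor

theorem mainTheorem2 :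
    Nonempty ConeTensor.{u} ∧
    ∀ T : ConeTensor.{u},
      (∀ (P Q R : SCCLin.{u}) (b : SCCLin.Bilin P Q R),
        (∀ (x : P) (y : Q), T.lift b (T.tmul x y) = b x y) ∧
        ∀ g : T.obj P Q ⟶ R, (∀ (x : P) (y : Q), g (T.tmul x y) = b x y) → g = T.lift b) ∧
      (∀ X Y : PCS.{u}, X.IsCube → Y.IsCube → IsIso (T.clComparison X Y)) ∧
      ∃ c : T.Coherence,
        c.ExtendsPCS (fun _ => True) ∧
        (∀ c' : T.Coherence, c'.ExtendsPCS PCS.IsCube → c' = c) ∧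
        c.OnPureTensors ∧
        ∃ h : c.IsSymmetricMonoidal,
          letI := ConeTensor.Coherence.monoidalCategory h
          letI := ConeTensor.Coherence.symmetricCategory h
          ∃ adj : ∀ P : SCCLin.{u},
              MonoidalCategory.tensorRight P ⊣ SCCLin.linHomFunctor.obj (Opposite.op P),
            ∀ P Q : SCCLin.{u},
              (adj P).counit.app Q = T.ev P Q ∧
              ∀ (f : SCCLin.linHom P Q) (x : P), T.ev P Q (T.tmul f x) = f x := by
  refine ⟨⟨SCCLin.coneTensor⟩, fun T => ⟨fun P Q R b => ⟨ConeTensor.lift_tmul b, fun g hg =>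
    ConeTensor.hom_ext fun x y => (hg x y).trans (ConeTensor.lift_tmul b x y).symm⟩,
    fun X Y => T.isIso_clComparison, T.coherence, T.coherence_extendsPCS _,
    fun c' => (T.coherence_extendsPCS _).unique, T.coherence_onPureTensors,
    T.coherence_isSymmetricMonoidal, T.adjunction, fun P Q => ⟨T.adjunction_counit_app P Q,
      fun f x => ConeTensor.lift_tmul _ f x⟩⟩⟩
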